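/- **Setting.** Let $n\ge 1$ and let $P$ be a natural unit interval order on $[n]=\{1,\dots,n\}$: there is a weakly increasing sequence $(m_1,\dots,m_n)$ with $i\le m_i\le n$ such that $i<_P j$ if and only if $m_i<j$. Let $\mathrm{inc}(P)$ be the graph on $[n]$ in which $i\ne j$ are adjacent if and only if they are incomparable in $P$. Let $\mu=(\mu_1,\dots,\mu_n)\in\mathbb{N}^n$. A *proper multi-coloring of type $\mu$* is a map $\kappa$ from $[n]$ to the finite subsets of $\{1,2,3,\dots\}$ with $|\kappa(i)|=\mu_i$ for all $i$, and $\kappa(i)\cap\kappa(j)=\emptyset$ whenever $i,j$ are adjacent in $\mathrm{inc}(P)$. Put $x^\kappa=\prod_i\prod_{k\in\kappa(i)}x_k$, let $\mathrm{asc}(\kappa)$ be the number of pairs $((i,r),(j,s))$ with $i<j$ adjacent in $\mathrm{inc}(P)$, $r\in\kappa(i)$, $s\in\kappa(j)$ and $r<s$, and define $$X_P(\mathbf{x},q;\mu)=\sum_{\kappa}q^{\mathrm{asc}(\kappa)}x^{\kappa},$$ the sum being over all proper multi-colorings of type $\mu$. Let $\mathrm{Sym}=\mathbb{Q}[e_1,e_2,\dots]$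 be the ring of symmetric functions over $\mathbb{Q}$ in $x_1,x_2,\dots$, let $\omega$ be its endomorphism with $\omega(e_k)=h_k$ for all $k\ge1$ ($e_k$ elementary, $h_k$ complete homogeneous), and for a partition $\lambda$ let $f_\lambda=\omega(m_\lambda)$ be the forgotten symmetric function, where $m_\lambda$ is the monomial symmetric function. A word $w=w_1\cdots w_d$ on the alphabet $[n]$ has *type $\mu$* if each letter $i$ occurs exactly $\mu_i$ times in it. It *has no $P$-descents* if there is no $i<d$ with $w_i>_P w_{i+1}$. Let $\mathrm{inv}_P(w)$ be the number of pairs $i<j$ such that $w_i$ and $w_j$ are incomparable in $P$ and $w_i>w_j$ as integers. **Theorem.** The function $X_P(\mathbf{x},q;\mu)$ is a finite linear combination $\sum_\lambda a_\lambda(q)f_\lambda(\mathbf{x})$ of forgotten symmetric functions with coefficients $a_\lambda(q)\in\mathbb{Q}[q]$, where $\lambda$ ranges over partitions. In every such expansion, for every partition $\lambda=(\lambda_1\ge\dots\ge\lambda_\ell)$, $$a_\lambda(q)=\sum_{w}q^{\mathrm{inv}_P(w)},$$ where $w$ ranges over all words of type $\mu$ that split from left to right into consecutive segments of lengths $\lambda_1,\lambda_2,\dots,\lambda_\ell$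 each of which has no $P$-descents. (In particular $a_\lambda(q)=0$ unless $\lambda$ is a partition of $\mu_1+\dots+\mu_n$.) -/

import Mathlib

noncomputable section

namespace SymFn

open MvPowerSeries

/-- The ring of symmetric functions over `R` in the variables `x_0, x_1, x_2, …`: the formal power
series of bounded degree that are invariant under all permutations of the variables. -/
def Sym (R : Type*) [CommRing R] : Subalgebra R (MvPowerSeries ℕ R) where
  carrier := {f | (∃ N : ℕ, ∀ d : ℕ →₀ ℕ, N < d.degree → coeff d f = 0) ∧
    ∀ σ : Equiv.Perm ℕ, rename σ f = f}
  mul_mem' := by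
    rintro f g ⟨⟨M, hM⟩, hf⟩ ⟨⟨N, hN⟩, hg⟩
    refine ⟨⟨M + N, fun d hd => ?_⟩, fun σ => by rw [map_mul, hf, hg]⟩
    classical
    rw [coeff_mul]
    refine Finset.sum_eq_zero fun p hp => ?_
    have h : p.1.degree + p.2.degree = d.degree := by
      rw [← map_add, Finset.HasAntidiagonal.mem_antidiagonal.1 hp]
    rcases lt_or_ge M p.1.degree with h1 | h1
    · rw [hM _ h1, zero_mul]
    · rw [hN _ (by omega), mul_zero]
  add_mem' := by
    rintro f g ⟨⟨M, hM⟩, hf⟩ ⟨⟨N, hN⟩, hg⟩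
    refine ⟨⟨M + N, fun d hd => ?_⟩, fun σ => by rw [map_add, hf, hg]⟩
    rw [map_add, hM _ (by omega), hN _ (by omega), add_zero]
  algebraMap_mem' r := by
    refine ⟨⟨0, fun d hd => ?_⟩, fun σ => AlgHom.commutes _ r⟩
    classical
    have hd0 : d ≠ 0 := by rintro rfl; simp at hd
    rw [MvPowerSeries.algebraMap_apply, coeff_C]
    simp [hd0]

/-- A power series whose coefficients are a bounded-degree function of the monomial, unchanged when
the variables are permuted, is symmetric. -/
theorem mem_Sym_of_coeff {R : Type*} [CommRing R] {f : MvPowerSeries ℕ R} (N : ℕ)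
    (hN : ∀ d : ℕ →₀ ℕ, N < d.degree → coeff d f = 0)
    (hf : ∀ (σ : Equiv.Perm ℕ) (d : ℕ →₀ ℕ), coeff (d.embDomain σ.toEmbedding) f = coeff d f) :
    f ∈ Sym R := by
  refine ⟨⟨N, hN⟩, fun σ => ?_⟩
  ext d
  obtain ⟨d', rfl⟩ : ∃ d' : ℕ →₀ ℕ, d'.embDomain σ.toEmbedding = d := by
    refine ⟨d.embDomain σ.symm.toEmbedding, ?_⟩
    ext i
    simp only [Finsupp.embDomain_eq_mapDomain, Equiv.coe_toEmbedding]
    rw [← Finsupp.mapDomain_comp]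
    simp
  rw [hf]
  exact coeff_embDomain_rename σ.toEmbedding f d'

theorem coeff_embDomain_of_mem_Sym {R : Type*} [CommRing R] {f : MvPowerSeries ℕ R}
    (hf : f ∈ Sym R) (σ : Equiv.Perm ℕ) (d : ℕ →₀ ℕ) :
    coeff (d.embDomain σ.toEmbedding) f = coeff d f := by
  conv_lhs => rw [← hf.2 σ]
  exact coeff_embDomain_rename σ.toEmbedding f d

theorem degree_embDomain {α β : Type*} (e : α ↪ β) (d : α →₀ ℕ) :
    (d.embDomain e).degree = d.degree := by
  simp [Finsupp.degree_apply, Finsupp.support_embDomain]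

open Classical in
/-- The elementary symmetric function `e_k`: the sum of all squarefree monomials of degree `k`. -/
def e (R : Type*) [CommRing R] (k : ℕ) : Sym R :=
  ⟨fun d => if (∀ i, d i ≤ 1) ∧ d.degree = k then 1 else 0, by
    refine mem_Sym_of_coeff k (fun d hd => ?_) fun σ d => ?_
    · exact if_neg fun h => hd.ne' h.2
    · refine if_congr ?_ rfl rfl
      rw [degree_embDomain]
      refine and_congr_left fun _ => ?_
      rw [← σ.forall_congr_right]
      refine forall_congr' fun i => ?_
      rw [← Equiv.coe_toEmbedding, Finsupp.embDomain_apply_self]⟩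

/-- The complete homogeneous symmetric function `h_k`: the sum of all monomials of degree `k`. -/
def h (R : Type*) [CommRing R] (k : ℕ) : Sym R :=
  ⟨fun d => if d.degree = k then 1 else 0, by
    refine mem_Sym_of_coeff k (fun d hd => ?_) fun σ d => ?_
    · exact if_neg hd.ne'
    · exact if_congr (by rw [degree_embDomain]) rfl rfl⟩

/-- The monomial symmetric function `m_ν`: the sum of all (distinct) monomials whose nonzero
exponents are, up to order, the parts of `ν`. -/
def m (R : Type*) [CommRing R] {k : ℕ} (ν : k.Partition) : Sym R :=
  ⟨fun d => if d.support.val.map d = ν.parts then 1 else 0, by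
    refine mem_Sym_of_coeff k (fun d hd => ?_) fun σ d => ?_
    · refine if_neg fun h => hd.ne' ?_
      rw [Finsupp.degree_apply, ← ν.parts_sum, ← h]
      rfl
    · refine if_congr ?_ rfl rfl
      rw [Finsupp.support_embDomain, Finset.map_val, Multiset.map_map]
      rw [show ⇑(d.embDomain σ.toEmbedding) ∘ ⇑σ.toEmbedding = ⇑d from
        funext fun i => Finsupp.embDomain_apply_self _ _ _]⟩

/-- The substitution `X_k ↦ e_{k+1}` from the polynomial ring in `X_0, X_1, …`. -/
def eHom (R : Type*) [CommRing R] : MvPolynomial ℕ R →ₐ[R] Sym R :=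
  MvPolynomial.aeval fun k => e R (k + 1)

/-- Setting `x_N = x_{N+1} = ⋯ = 0` in `e_k` gives the elementary symmetric polynomial. -/
theorem killCompl_e (R : Type*) [CommRing R] (N k : ℕ) :
    killCompl Fin.valEmbedding (e R k : MvPowerSeries ℕ R) =
      ((MvPolynomial.esymm (Fin N) R k : MvPolynomial (Fin N) R) : MvPowerSeries (Fin N) R) := by
  classical
  ext d
  rw [coeff_killCompl, MvPolynomial.coeff_coe, MvPolynomial.esymm_eq_sum_monomial,
    MvPolynomial.coeff_sum]
  simp only [MvPolynomial.coeff_monomial]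
  have hcoeff : coeff (d.embDomain Fin.valEmbedding) (e R k : MvPowerSeries ℕ R) =
      if (∀ i, d.embDomain Fin.valEmbedding i ≤ 1) ∧ (d.embDomain Fin.valEmbedding).degree = k
        then (1 : R) else 0 := rfl
  have hle : (∀ i, d.embDomain Fin.valEmbedding i ≤ 1) ↔ ∀ i, d i ≤ 1 := by
    refine ⟨fun h i => ?_, fun h j => ?_⟩
    · rw [← Finsupp.embDomain_apply_self Fin.valEmbedding d i]; exact h _
    · by_cases hj : j ∈ Set.range (Fin.valEmbedding (n := N))
      · obtain ⟨i, rfl⟩ := hj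
        rw [Finsupp.embDomain_apply_self]; exact h i
      · rw [Finsupp.embDomain_of_notMem_range _ _ _ hj]; exact zero_le_one
  have key : ∀ t : Finset (Fin N), (∑ i ∈ t, Finsupp.single i 1 = d) ↔
      (∀ i, d i ≤ 1) ∧ d.support = t := by
    intro t
    have ht : ∀ i, (∑ i ∈ t, Finsupp.single i 1 : Fin N →₀ ℕ) i = if i ∈ t then 1 else 0 := by
      intro i
      simp [Finsupp.finsetSum_apply, Finsupp.single_apply]
    constructor
    · rintro rfl
      refine ⟨fun i => ?_, ?_⟩
      · rw [ht]; split_ifs <;> simp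
      · ext i; rw [Finsupp.mem_support_iff, ht]; simp
    · rintro ⟨h1, rfl⟩
      ext i
      rw [ht]
      have := h1 i
      by_cases hi : d i = 0
      · simp [hi]
      · rw [if_pos (Finsupp.mem_support_iff.2 hi)]; omega
  rw [hcoeff, degree_embDomain, hle]
  simp only [key]
  by_cases h1 : ∀ i, d i ≤ 1
  · have hdeg : d.degree = d.support.card := by
      rw [Finsupp.degree_apply, Finset.card_eq_sum_ones]
      refine Finset.sum_congr rfl fun i hi => ?_
      have := h1 i
      have := Finsupp.mem_support_iff.1 hi
      omega
    simp only [h1, implies_true, true_and, hdeg]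
    rw [Finset.sum_ite_eq]
    simp [Finset.mem_powersetCard]
  · simp only [h1, false_and, if_false, Finset.sum_const_zero]

theorem killCompl_eHom (R : Type*) [CommRing R] (N : ℕ) (p : MvPolynomial (Fin N) R) :
    killCompl Fin.valEmbedding (eHom R (MvPolynomial.rename Fin.val p) : MvPowerSeries ℕ R) =
      (((MvPolynomial.esymmAlgHom (Fin N) R N p).1 : MvPolynomial (Fin N) R) :
        MvPowerSeries (Fin N) R) := by
  have key : ((killCompl Fin.valEmbedding).comp ((Sym R).val.comp
      ((eHom R).comp (MvPolynomial.rename Fin.val)))) =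
      (MvPolynomial.coeToMvPowerSeries.algHom (σ := Fin N) (R := R) R).comp
        ((MvPolynomial.symmetricSubalgebra (Fin N) R).val.comp
          (MvPolynomial.esymmAlgHom (Fin N) R N)) := by
    refine MvPolynomial.algHom_ext fun i => ?_
    simp [eHom, MvPolynomial.esymmAlgHom, killCompl_e, MvPolynomial.coeToMvPowerSeries.algHom_apply]
  have := AlgHom.congr_fun key p
  simpa [MvPolynomial.coeToMvPowerSeries.algHom_apply] using this

/-- `X_k` is given weight `k + 1`, the degree of `e_{k+1}`. -/
theorem coeff_eHom_monomial (R : Type*) [CommRing R] (t : ℕ →₀ ℕ) (r : R) (d : ℕ →₀ ℕ)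
    (hd : d.degree ≠ Finsupp.weight (fun k => k + 1) t) :
    coeff d (eHom R (MvPolynomial.monomial t r) : MvPowerSeries ℕ R) = 0 := by
  classical
  induction t using Finsupp.induction generalizing d r with
  | zero =>
    have hd0 : d ≠ 0 := by rintro rfl; simp at hd
    have : (eHom R (MvPolynomial.monomial 0 r) : MvPowerSeries ℕ R) = MvPowerSeries.C r := by
      rw [show MvPolynomial.monomial (0 : ℕ →₀ ℕ) r = algebraMap R _ r from rfl, AlgHom.commutes]
      rfl
    rw [this, coeff_C, if_neg hd0]
  | single_add a b f _ _ ih =>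
    clear * - ih hd
    induction b generalizing d with
    | zero => simp at hd; simpa using ih r d hd
    | succ b ihb =>
      have h1 : MvPolynomial.monomial (Finsupp.single a (b + 1) + f) r =
          MvPolynomial.X a * MvPolynomial.monomial (Finsupp.single a b + f) r := by
        rw [MvPolynomial.X, MvPolynomial.monomial_mul, one_mul, ← add_assoc, ← Finsupp.single_add,
          add_comm 1 b]
      have h2 : eHom R (MvPolynomial.X a) = e R (a + 1) := by simp [eHom]
      rw [h1, map_mul, h2, Subalgebra.coe_mul, coeff_mul]
      refine Finset.sum_eq_zero fun p hp => ?_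
      have h : p.1.degree + p.2.degree = d.degree := by
        rw [← map_add, Finset.HasAntidiagonal.mem_antidiagonal.1 hp]
      by_cases hp1 : p.1.degree = a + 1
      · rw [ihb p.2, mul_zero]
        intro h3
        apply hd
        rw [← h, hp1, h3]
        simp only [map_add, Finsupp.weight_single, smul_eq_mul]
        ring
      · rw [show coeff p.1 (e R (a + 1) : MvPowerSeries ℕ R) = 0 from if_neg fun h => hp1 h.2,
          zero_mul]

/-- Two symmetric functions agree on a monomial in at most `N` variables as soon as they agree after
setting `x_N = x_{N+1} = ⋯ = 0`. -/
theorem coeff_eq_of_killCompl_eq {R : Type*} [CommRing R] {f g : MvPowerSeries ℕ R} (hf : f ∈ Sym R)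
    (hg : g ∈ Sym R) {N : ℕ} (h : killCompl (Fin.valEmbedding (n := N)) f =
      killCompl (Fin.valEmbedding (n := N)) g) (d : ℕ →₀ ℕ) (hd : d.degree ≤ N) :
    coeff d f = coeff d g := by
  classical
  have hcard : d.support.card ≤ N := by
    refine le_trans ?_ hd
    rw [Finsupp.degree_apply, Finset.card_eq_sum_ones]
    exact Finset.sum_le_sum fun i hi => Nat.one_le_iff_ne_zero.2 (Finsupp.mem_support_iff.1 hi)
  obtain ⟨σ, hσ⟩ : ∃ σ : Equiv.Perm ℕ, ∀ i ∈ d.support, σ i < N := by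
    let s : Set ℕ := d.support
    let t : Set ℕ := (Finset.range d.support.card : Finset ℕ)
    have e1 : Nonempty (s ≃ t) := ⟨Finset.equivOfCardEq (by simp)⟩
    have e2 : Nonempty ((sᶜ : Set ℕ) ≃ (tᶜ : Set ℕ)) := by
      have : Infinite (sᶜ : Set ℕ) := (Finset.finite_toSet _).infinite_compl.to_subtype
      have : Infinite (tᶜ : Set ℕ) := (Finset.finite_toSet _).infinite_compl.to_subtype
      exact nonempty_equiv_of_countable
    obtain ⟨e1⟩ := e1
    obtain ⟨e2⟩ := e2
    refine ⟨(Equiv.Set.sumCompl s).symm.trans ((Equiv.sumCongr e1 e2).trans (Equiv.Set.sumCompl t)),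
      fun i hi => ?_⟩
    have hi' : i ∈ s := hi
    rw [Equiv.trans_apply, Equiv.Set.sumCompl_symm_apply_of_mem hi']
    simp only [Equiv.trans_apply, Equiv.sumCongr_apply, Sum.map_inl, Equiv.Set.sumCompl_apply_inl]
    have := (e1 ⟨i, hi'⟩).2
    simp only [t, Finset.coe_range, Set.mem_Iio] at this
    omega
  rw [← coeff_embDomain_of_mem_Sym hf σ d, ← coeff_embDomain_of_mem_Sym hg σ d]
  obtain ⟨d', hd'⟩ : ∃ d' : Fin N →₀ ℕ,
      d'.embDomain Fin.valEmbedding = d.embDomain σ.toEmbedding := by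
    have : d.embDomain σ.toEmbedding ∈ Set.range (Finsupp.embDomain (Fin.valEmbedding (n := N))) := by
      rw [Finsupp.mem_range_embDomain_iff]
      intro j hj
      rw [Finsupp.support_embDomain] at hj
      obtain ⟨i, hi, rfl⟩ := Finset.mem_map.1 hj
      exact ⟨⟨σ i, hσ i hi⟩, rfl⟩
    exact this
  rw [← hd', ← coeff_killCompl, ← coeff_killCompl, h]

/-- Setting `x_N = x_{N+1} = ⋯ = 0` in a symmetric function gives a symmetric polynomial. -/
theorem exists_symmetric_eq_killCompl {R : Type*} [CommRing R] {f : MvPowerSeries ℕ R}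
    (hf : f ∈ Sym R) (N : ℕ) : ∃ g : MvPolynomial (Fin N) R, g.IsSymmetric ∧
      (g : MvPowerSeries (Fin N) R) = killCompl Fin.valEmbedding f := by
  obtain ⟨M, hM⟩ := hf.1
  let b : Fin N →₀ ℕ := Finsupp.equivFunOnFinite.symm fun _ => M
  have hcoe : ((trunc' R b (killCompl Fin.valEmbedding f) : MvPolynomial (Fin N) R) :
      MvPowerSeries (Fin N) R) = killCompl Fin.valEmbedding f := by
    ext d
    rw [MvPolynomial.coeff_coe, coeff_trunc']
    split_ifs with hd
    · rfl
    · obtain ⟨i, hi⟩ : ∃ i, M < d i := by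
        by_contra! hcon
        exact hd fun i => hcon i
      rw [coeff_killCompl, hM]
      rw [degree_embDomain]
      exact hi.trans_le (Finsupp.le_degree i d)
  refine ⟨_, fun σ => ?_, hcoe⟩
  apply MvPolynomial.coe_injective
  have h1 := rename_coe (f := σ) (trunc' R b (killCompl Fin.valEmbedding f))
  rw [← h1, hcoe]
  ext d
  obtain ⟨d', rfl⟩ : ∃ d' : Fin N →₀ ℕ, d'.embDomain σ.toEmbedding = d := by
    refine ⟨d.embDomain σ.symm.toEmbedding, ?_⟩
    simp only [Finsupp.embDomain_eq_mapDomain, Equiv.coe_toEmbedding]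
    rw [← Finsupp.mapDomain_comp]
    simp
  refine (coeff_embDomain_rename σ.toEmbedding _ d').trans ?_
  rw [coeff_killCompl, coeff_killCompl,
    ← coeff_embDomain_of_mem_Sym hf (Equiv.Perm.viaEmbedding σ Fin.valEmbedding)]
  congr 2
  simp only [Finsupp.embDomain_eq_mapDomain]
  rw [← Finsupp.mapDomain_comp, ← Finsupp.mapDomain_comp]
  congr 1
  funext i
  exact Equiv.Perm.viaEmbedding_apply σ Fin.valEmbedding i

/-- The fundamental theorem: every symmetric function is a unique polynomial in `e_1, e_2, …`. -/
theorem eHom_bijective (R : Type*) [CommRing R] : Function.Bijective (eHom R) := by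
  classical
  constructor
  · rw [injective_iff_map_eq_zero]
    intro p hp
    obtain ⟨q, hq⟩ := MvPolynomial.exists_rename_eq_of_vars_subset_range p
      (Fin.val (n := p.vars.sup id + 1)) Fin.val_injective fun i hi =>
        ⟨⟨i, Nat.lt_succ_of_le (Finset.le_sup (f := id) hi)⟩, rfl⟩
    have h := killCompl_eHom R _ q
    rw [hq, hp] at h
    have h0 : MvPolynomial.esymmAlgHom (Fin (p.vars.sup id + 1)) R _ q = 0 := by
      apply Subtype.ext
      apply MvPolynomial.coe_injective
      simpa using h.symm
    rw [← hq, (injective_iff_map_eq_zero _).1 (MvPolynomial.esymmAlgHom_fin_injective R le_rfl) q h0,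
      map_zero]
  · rintro ⟨f, hf⟩
    obtain ⟨N, hN⟩ := hf.1
    obtain ⟨g, hg, hgf⟩ := exists_symmetric_eq_killCompl hf N
    obtain ⟨p', hp'⟩ := (MvPolynomial.esymmAlgHom_fin_bijective R N).2 ⟨g, hg⟩
    let p := MvPolynomial.rename Fin.val p'
    have hK : killCompl (Fin.valEmbedding (n := N)) (eHom R p : MvPowerSeries ℕ R) =
        killCompl Fin.valEmbedding f := by
      rw [killCompl_eHom, hp', hgf]
    let wt : (ℕ →₀ ℕ) → ℕ := fun t => Finsupp.weight (fun k => k + 1) t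
    have hco : ∀ (s : Finset (ℕ →₀ ℕ)) (d : ℕ →₀ ℕ),
        coeff d (eHom R (∑ t ∈ s, MvPolynomial.monomial t (p.coeff t)) : MvPowerSeries ℕ R) =
          ∑ t ∈ s, coeff d (eHom R (MvPolynomial.monomial t (p.coeff t)) : MvPowerSeries ℕ R) := by
      intro s d
      rw [map_sum, AddSubmonoidClass.coe_finsetSum, map_sum]
    refine ⟨∑ t ∈ p.support with wt t ≤ N, MvPolynomial.monomial t (p.coeff t), ?_⟩
    apply Subtype.ext
    ext d
    rw [hco]
    by_cases hd : d.degree ≤ N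
    · change _ = coeff d f
      rw [← coeff_eq_of_killCompl_eq (eHom R p).2 hf hK d hd]
      conv_rhs => rw [p.as_sum]
      rw [hco, Finset.sum_filter]
      refine Finset.sum_congr rfl fun t _ => ?_
      split_ifs with ht
      · rfl
      · exact (coeff_eHom_monomial R t _ d fun h => ht (h.symm.trans_le hd)).symm
    · change _ = coeff d f
      rw [hN d (by omega)]
      refine Finset.sum_eq_zero fun t ht => ?_
      refine coeff_eHom_monomial R t _ d fun h => hd ?_
      rw [h]
      exact (Finset.mem_filter.1 ht).2

/-- `Sym R = R[e_1, e_2, …]`. -/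
def eEquiv (R : Type*) [CommRing R] : MvPolynomial ℕ R ≃ₐ[R] Sym R :=
  AlgEquiv.ofBijective (eHom R) (eHom_bijective R)

/-- The endomorphism `ω` of `Sym R = R[e_1, e_2, …]` with `ω(e_k) = h_k` for all `k ≥ 1`. -/
def omega (R : Type*) [CommRing R] : Sym R →ₐ[R] Sym R :=
  (MvPolynomial.aeval fun k => h R (k + 1)).comp (eEquiv R).symm.toAlgHom

theorem omega_e (R : Type*) [CommRing R] (k : ℕ) : omega R (e R (k + 1)) = h R (k + 1) := by
  have : (eEquiv R).symm (e R (k + 1)) = MvPolynomial.X k := by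
    rw [AlgEquiv.symm_apply_eq]
    simp [eEquiv, eHom]
  simp [omega, this]

/-- The forgotten symmetric function `f_ν = ω(m_ν)`. -/
def forgotten (R : Type*) [CommRing R] {k : ℕ} (ν : k.Partition) : Sym R := omega R (m R ν)

end SymFn

/-- A natural unit interval order on `{0, …, n - 1}`, given by a weakly increasing sequence `m` with
`i ≤ m i`. -/
structure NatUnitIntervalOrder (n : ℕ) where
  m : Fin n → Fin n
  monotone_m : Monotone m
  le_m : ∀ i, i ≤ m i

namespace NatUnitIntervalOrder

variable {n : ℕ} (P : NatUnitIntervalOrder n)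

/-- The order relation `a <_P b`. -/
def lt (a b : Fin n) : Prop := P.m a < b

theorem isStrictOrder : IsStrictOrder (Fin n) P.lt where
  irrefl a h := absurd h (P.le_m a).not_gt
  trans _ b _ hab hbc := (hab.trans_le (P.le_m b)).trans hbc

/-- The incomparability graph of `P`. -/
def inc : SimpleGraph (Fin n) where
  Adj a b := a ≠ b ∧ ¬ P.lt a b ∧ ¬ P.lt b a
  symm := ⟨fun _ _ h => ⟨h.1.symm, h.2.2, h.2.1⟩⟩
  loopless := ⟨fun _ h => h.1 rfl⟩

/-- The `P`-descent set of a word, positions being counted from `0`. -/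
def desSet (w : List (Fin n)) : Set ℕ :=
  {i | ∃ hi : i + 1 < w.length, P.lt w[i + 1] w[i]}

open Classical in
/-- The number of `P`-inversion pairs of a word. -/
def inv (w : List (Fin n)) : ℕ :=
  (Finset.univ.filter fun p : Fin w.length × Fin w.length =>
    p.1 < p.2 ∧ P.inc.Adj (w.get p.1) (w.get p.2) ∧ w.get p.2 < w.get p.1).card

/-- `w` splits from left to right into consecutive segments whose lengths are the entries of `L`
(so that `w` has length `L.sum`), each of which has no `P`-descents. -/
def SegmentsDescentFree (L : List ℕ) (w : List (Fin n)) : Prop :=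
  ∃ s : List (List (Fin n)), s.flatten = w ∧ s.map List.length = L ∧ ∀ v ∈ s, P.desSet v = ∅

end NatUnitIntervalOrder

/-- The finite set of words of type `μ`. -/
def wordsOfType {n : ℕ} (μ : Fin n → ℕ) : Finset (List (Fin n)) :=
  ((Finset.univ : Finset (Fin (∑ i, μ i) → Fin n)).image List.ofFn).filter
    fun w => ∀ i, w.count i = μ i

theorem mem_wordsOfType {n : ℕ} (μ : Fin n → ℕ) (w : List (Fin n)) :
    w ∈ wordsOfType μ ↔ ∀ i, w.count i = μ i := by
  simp only [wordsOfType, Finset.mem_filter, Finset.mem_image, Finset.mem_univ, true_and,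
    and_iff_right_iff_imp]
  intro hw
  have hl : w.length = ∑ i, μ i := by
    simp only [← hw]
    have := Multiset.sum_count_eq_card (s := Finset.univ) (m := (w : Multiset (Fin n)))
      (fun _ _ => Finset.mem_univ _)
    simpa using this.symm
  rw [← hl]
  exact ⟨w.get, List.ofFn_get w⟩

section Chromatic

open Polynomial

variable {n : ℕ} (G : SimpleGraph (Fin n)) (μ : Fin n → ℕ)

/-- `κ` is a proper multi-coloring of `G` of type `μ`; the colours are `0, 1, 2, …`. -/
def IsProperMultiColoring (κ : Fin n → Finset ℕ) : Prop :=
  (∀ i, (κ i).card = μ i) ∧ ∀ i j, G.Adj i j → Disjoint (κ i) (κ j)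

/-- The exponent vector of the monomial `x^κ`. -/
def colorContent (κ : Fin n → Finset ℕ) : ℕ →₀ ℕ :=
  ∑ i, ∑ k ∈ κ i, Finsupp.single k 1

open Classical in
/-- The number of pairs `((i, r), (j, s))` with `i`, `j` adjacent, `i < j`, `r ∈ κ i`, `s ∈ κ j` and
`r < s`. -/
def asc (κ : Fin n → Finset ℕ) : ℕ :=
  ((Finset.univ.sigma κ ×ˢ Finset.univ.sigma κ).filter
    fun p : (Σ _ : Fin n, ℕ) × (Σ _ : Fin n, ℕ) =>
      G.Adj p.1.1 p.2.1 ∧ p.1.1 < p.2.1 ∧ p.1.2 < p.2.2).card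

open Classical in
/-- The multi-chromatic quasisymmetric function `X_G(x, q; μ)`, with `q` the variable of `ℚ[X]`: the
coefficient of `x^d` is the sum of `q^{asc κ}` over the proper multi-colorings `κ` of type `μ` with
`x^κ = x^d`. Such a `κ` uses only colours in the support of `d`, so they form a finite set. -/
def chromaticQSym : MvPowerSeries ℕ ℚ[X] := fun d =>
  ∑ κ ∈ (Fintype.piFinset fun _ : Fin n => d.support.powerset) with
    IsProperMultiColoring G μ κ ∧ colorContent κ = d, (X : ℚ[X]) ^ asc G κ

/-- The combination `∑_λ a_λ(q) f_λ(x)` of forgotten symmetric functions over `ℚ`, for a finitely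
supported family `a` of polynomials in `q` indexed by all partitions. -/
def forgottenSum (a : (Σ k : ℕ, k.Partition) →₀ ℚ[X]) : MvPowerSeries ℕ ℚ[X] :=
  a.sum fun ν c => c • MvPowerSeries.map (C : ℚ →+* ℚ[X])
    (SymFn.forgotten ℚ ν.2 : MvPowerSeries ℕ ℚ)

end Chromatic

end

/-! Let `b_k` be the sum of the words of length `k` that strictly decrease in `P`, and `a_k` the sum
of the words of length `k` without `P`-descents, both in the free associative algebra on `[n]`.
Cutting a word into a decreasing prefix and a descent-free suffix gives a sign-reversing
cancellation, so `∑ (-1)^i b_i a_{k-i} = 0` for `k > 0` (`sum_decWords_mul_ascWords`). These are the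
relations between the `h_k` and the `e_k`.

Consider the functional sending a word `w` of type `μ` to `q^{inv w}` and every other word to `0`.
It does not distinguish `b_i b_j` from `b_j b_i`, even inside a longer product
(`sum_decWords_wordWeight_comm`). This is the one place where the unit interval structure is
essential. It amounts to the symmetry in two colours of the generating function of colourings by
chains, proved by adding a new least element to the vertex set (`exists_symm_splitWeight`).

As far as this functional is concerned, the `b_k` therefore commute, and `e_k ↦ a_k`, `h_k ↦ b_k`
behaves as a ring homomorphism. It is applied in `y` to the dual Cauchy identity `∑_ν f_ν(x) e_ν(y)
= ∑_d x^d h_d(y)` (`sum_coeff_forgotten_smul_eProd`). On the left, `e_ν` becomes the sum over words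
split into descent-free segments of lengths `ν`. On the right, `h_d` becomes the sum over sequences
of chains of sizes `d_c`, that is, over proper multi-colorings with content `d`. Reading the colour
classes from the largest colour down turns ascents into inversions, so the right side is `X_P`
(`coeff_chromaticQSym_inc`). Uniqueness of the coefficients is the linear independence of the `f_ν`,
which follows from that of the `m_ν` because `ω` is an involution. -/

namespace SymFn

open MvPowerSeries Finset

/-! ### Products of `e_k` and of `h_k`, and the involution `ω`. -/

/-- The transpose of a finitely supported matrix. -/
noncomputable def finsuppTranspose (l : ℕ →₀ ℕ →₀ ℕ) : ℕ →₀ ℕ →₀ ℕ :=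
  (Finsupp.equivMapDomain (Equiv.prodComm ℕ ℕ) l.uncurry).curry

theorem finsuppTranspose_apply (l : ℕ →₀ ℕ →₀ ℕ) (i j : ℕ) :
    finsuppTranspose l i j = l j i := by
  simp [finsuppTranspose, Finsupp.curry_apply, Finsupp.equivMapDomain_apply,
    Finsupp.uncurry_apply]

theorem finsuppTranspose_finsuppTranspose (l : ℕ →₀ ℕ →₀ ℕ) :
    finsuppTranspose (finsuppTranspose l) = l := by
  ext i j
  simp [finsuppTranspose_apply]

theorem degree_eq_sum_of_subset {d : ℕ →₀ ℕ} {s : Finset ℕ} (hs : d.support ⊆ s) :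
    d.degree = ∑ i ∈ s, d i := by
  rw [Finsupp.degree_apply]
  exact sum_subset hs fun i _ hi => by simpa using hi

/-- Rows of degrees `c i` that add up to `d` are a matrix with row sums `c` and column sums `d`. The
right-hand form is visibly invariant under transposition together with exchange of `c` and `d`. Rows
outside the support of `c` vanish, whence the need for `q 0`. -/
theorem mem_finsuppAntidiag_and_iff (q : ℕ → Prop) (hq : q 0) (c d : ℕ →₀ ℕ) (l : ℕ →₀ ℕ →₀ ℕ) :
    (l ∈ finsuppAntidiag c.support d ∧
      ∀ i ∈ c.support, (∀ j, q (l i j)) ∧ (l i).degree = c i) ↔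
    (∀ i j, l i j ≠ 0 → i ∈ c.support ∧ j ∈ d.support) ∧ (∀ j, ∑ i ∈ c.support, l i j = d j) ∧
      (∀ i, ∑ j ∈ d.support, l i j = c i) ∧ ∀ i j, q (l i j) := by
  rw [mem_finsuppAntidiag]
  constructor
  · rintro ⟨⟨h1, h2⟩, h3⟩
    have h4 : ∀ j, ∑ i ∈ c.support, l i j = d j := fun j => by
      rw [← h1, Finsupp.finsetSum_apply]
    have h5 : ∀ i, i ∉ c.support → l i = 0 := fun i hi => by
      by_contra h
      exact hi (h2 (Finsupp.mem_support_iff.2 h))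
    have h6 : ∀ i j, l i j ≠ 0 → i ∈ c.support ∧ j ∈ d.support := by
      intro i j hij
      have hi : i ∈ c.support := by
        by_contra hi
        exact hij (by rw [h5 i hi]; rfl)
      refine ⟨hi, Finsupp.mem_support_iff.2 fun h => hij ?_⟩
      rw [← h4 j] at h
      exact (sum_eq_zero_iff.1 h) i hi
    refine ⟨h6, h4, fun i => ?_, fun i j => ?_⟩
    · by_cases hi : i ∈ c.support
      · rw [← (h3 i hi).2, degree_eq_sum_of_subset (s := d.support)]
        exact fun j hj => (h6 i j (Finsupp.mem_support_iff.1 hj)).2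
      · rw [h5 i hi]
        simpa using (Finsupp.notMem_support_iff.1 hi).symm
    · by_cases hi : i ∈ c.support
      · exact (h3 i hi).1 j
      · rw [h5 i hi]; exact hq
  · rintro ⟨h6, h4, h3, hqq⟩
    refine ⟨⟨?_, fun i hi => ?_⟩, fun i hi => ⟨hqq i, ?_⟩⟩
    · ext j
      rw [Finsupp.finsetSum_apply, h4]
    · obtain ⟨j, hj⟩ := Finsupp.ne_iff.1 (Finsupp.mem_support_iff.1 hi)
      exact (h6 i j hj).1
    · rw [← h3 i, degree_eq_sum_of_subset (s := d.support)]
      exact fun j hj => (h6 i j (Finsupp.mem_support_iff.1 hj)).2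

open Classical in
theorem coeff_prod_eq_card {R : Type*} [CommRing R] {q : ℕ → Prop}
    {f : ℕ → MvPowerSeries ℕ R}
    {dec : ∀ (k : ℕ) (d : ℕ →₀ ℕ), Decidable ((∀ i, q (d i)) ∧ d.degree = k)}
    (hf : ∀ k d, coeff d (f k) = if (∀ i, q (d i)) ∧ d.degree = k then 1 else 0) (c d : ℕ →₀ ℕ) :
    coeff d (∏ i ∈ c.support, f (c i)) =
      #{l ∈ finsuppAntidiag c.support d |
        ∀ i ∈ c.support, (∀ j, q (l i j)) ∧ (l i).degree = c i} := by
  rw [coeff_prod]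
  simp only [hf, prod_ite_zero, prod_const_one, sum_boole]

/-- Both sides count matrices with entries satisfying `q` and prescribed row and column sums, and
transposition matches them. The predicate is `· ≤ 1` for the `e_k` and trivial for the `h_k`. -/
theorem coeff_prod_comm {R : Type*} [CommRing R] {q : ℕ → Prop} (hq : q 0)
    {f : ℕ → MvPowerSeries ℕ R} (dec : ∀ (k : ℕ) (d : ℕ →₀ ℕ), Decidable ((∀ i, q (d i)) ∧ d.degree = k))
    (hf : ∀ k d, coeff d (f k) = if (∀ i, q (d i)) ∧ d.degree = k then 1 else 0) (c d : ℕ →₀ ℕ) :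
    coeff d (∏ i ∈ c.support, f (c i)) = coeff c (∏ i ∈ d.support, f (d i)) := by
  classical
  rw [coeff_prod_eq_card hf, coeff_prod_eq_card hf]
  congr 1
  refine card_nbij' finsuppTranspose finsuppTranspose ?_ ?_
    (fun l _ => finsuppTranspose_finsuppTranspose l)
    (fun l _ => finsuppTranspose_finsuppTranspose l)
  all_goals
    intro l hl
    rw [mem_coe, mem_filter, mem_finsuppAntidiag_and_iff q hq] at hl ⊢
    simp only [finsuppTranspose_apply]
    obtain ⟨h1, h2, h3, h4⟩ := hl
    exact ⟨fun i j hij => (h1 j i hij).symm, h3, h2, fun i j => h4 j i⟩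

theorem degree_eq_of_coeff_prod_ne_zero {R : Type*} [CommRing R] {f : ℕ → MvPowerSeries ℕ R}
    (hf : ∀ k d, d.degree ≠ k → coeff d (f k) = 0) (c d : ℕ →₀ ℕ)
    (h : coeff d (∏ i ∈ c.support, f (c i)) ≠ 0) : d.degree = c.degree := by
  classical
  rw [coeff_prod] at h
  obtain ⟨l, hl, hl'⟩ := exists_ne_zero_of_sum_ne_zero h
  rw [mem_finsuppAntidiag] at hl
  rw [← hl.1, map_sum, Finsupp.degree_apply]
  refine sum_congr rfl fun i hi => ?_
  by_contra hne
  exact hl' (prod_eq_zero hi (hf _ _ hne))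

section CommRing

variable (R : Type*) [CommRing R]

/-- The product `∏ e_{c_i}`. -/
noncomputable def eProd (c : ℕ →₀ ℕ) : Sym R := ∏ i ∈ c.support, e R (c i)

/-- The product `∏ h_{c_i}`. -/
noncomputable def hProd (c : ℕ →₀ ℕ) : Sym R := ∏ i ∈ c.support, h R (c i)

open Classical in
theorem coeff_e (k : ℕ) (d : ℕ →₀ ℕ) : coeff d (e R k : MvPowerSeries ℕ R) =
    if (∀ i, d i ≤ 1) ∧ d.degree = k then 1 else 0 := rfl

theorem coeff_h (k : ℕ) (d : ℕ →₀ ℕ) : coeff d (h R k : MvPowerSeries ℕ R) =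
    if d.degree = k then 1 else 0 := rfl

theorem coe_eProd (c : ℕ →₀ ℕ) :
    (eProd R c : MvPowerSeries ℕ R) = ∏ i ∈ c.support, (e R (c i) : MvPowerSeries ℕ R) := by
  simp [eProd]

theorem coe_hProd (c : ℕ →₀ ℕ) :
    (hProd R c : MvPowerSeries ℕ R) = ∏ i ∈ c.support, (h R (c i) : MvPowerSeries ℕ R) := by
  simp [hProd]

theorem coeff_eProd_comm (c d : ℕ →₀ ℕ) :
    coeff d (eProd R c : MvPowerSeries ℕ R) = coeff c (eProd R d : MvPowerSeries ℕ R) := by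
  rw [coe_eProd, coe_eProd]
  exact coeff_prod_comm (q := (· ≤ 1)) zero_le_one (f := fun k => (e R k : MvPowerSeries ℕ R)) _
    (coeff_e R) c d

theorem coeff_hProd_comm (c d : ℕ →₀ ℕ) :
    coeff d (hProd R c : MvPowerSeries ℕ R) = coeff c (hProd R d : MvPowerSeries ℕ R) := by
  classical
  rw [coe_hProd, coe_hProd]
  refine coeff_prod_comm (q := fun _ => True) trivial (f := fun k => (h R k : MvPowerSeries ℕ R))
    inferInstance (fun k d => ?_) c d
  rw [coeff_h]
  simp

theorem coeff_eProd_of_degree_ne {c d : ℕ →₀ ℕ} (hcd : d.degree ≠ c.degree) :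
    coeff d (eProd R c : MvPowerSeries ℕ R) = 0 := by
  by_contra hne
  rw [coe_eProd] at hne
  refine hcd (degree_eq_of_coeff_prod_ne_zero (f := fun k => (e R k : MvPowerSeries ℕ R))
    (fun k d hd => ?_) c d hne)
  rw [coeff_e, if_neg fun h => hd h.2]

theorem coeff_hProd_of_degree_ne {c d : ℕ →₀ ℕ} (hcd : d.degree ≠ c.degree) :
    coeff d (hProd R c : MvPowerSeries ℕ R) = 0 := by
  by_contra hne
  rw [coe_hProd] at hne
  refine hcd (degree_eq_of_coeff_prod_ne_zero (f := fun k => (h R k : MvPowerSeries ℕ R))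
    (fun k d hd => ?_) c d hne)
  rw [coeff_h, if_neg hd]

theorem omega_eProd (c : ℕ →₀ ℕ) : omega R (eProd R c) = hProd R c := by
  rw [eProd, map_prod]
  refine prod_congr rfl fun i hi => ?_
  obtain ⟨k, hk⟩ := Nat.exists_eq_succ_of_ne_zero (Finsupp.mem_support_iff.1 hi)
  rw [hk]
  exact omega_e R k

theorem e_zero : e R 0 = 1 := by
  classical
  apply Subtype.ext
  ext d
  rw [coeff_e, OneMemClass.coe_one, coeff_one]
  refine if_congr ?_ rfl rfl
  rw [Finsupp.degree_eq_zero_iff]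
  exact ⟨fun h => h.2, fun h => ⟨by simp [h], h⟩⟩

theorem h_zero : h R 0 = 1 := by
  classical
  apply Subtype.ext
  ext d
  rw [coeff_h, OneMemClass.coe_one, coeff_one]
  exact if_congr (Finsupp.degree_eq_zero_iff d) rfl rfl

open Classical in
-- The squarefree divisors of `x^d` correspond to the subsets of the support of `d`, and the signed
-- count of subsets of a nonempty set is zero.
theorem sum_le_one_neg_one_pow (d : ℕ →₀ ℕ) (hd : d ≠ 0) :
    ∑ p ∈ antidiagonal d, (if ∀ i, p.1 i ≤ 1 then (-1 : R) ^ p.1.degree else 0) = 0 := by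
  have hz : ∑ s ∈ d.support.powerset, (-1 : ℤ) ^ #s = 0 :=
    sum_powerset_neg_one_pow_card_of_nonempty (Finsupp.support_nonempty_iff.2 hd)
  have hz' : ∑ s ∈ d.support.powerset, (-1 : R) ^ #s = 0 := by
    have := congrArg (Int.cast : ℤ → R) hz
    push_cast at this
    exact this
  have hind : ∀ (s : Finset ℕ) (i : ℕ),
      (∑ j ∈ s, Finsupp.single j 1 : ℕ →₀ ℕ) i = if i ∈ s then 1 else 0 := fun s i => by
    simp [Finsupp.finsetSum_apply, Finsupp.single_apply]
  refine Eq.trans ?_ hz'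
  rw [← sum_filter]
  symm
  refine sum_bij' (fun s _ => (∑ i ∈ s, Finsupp.single i 1, d - ∑ i ∈ s, Finsupp.single i 1))
    (fun p _ => p.1.support) ?_ ?_ ?_ ?_ ?_
  · intro s hs
    rw [mem_powerset] at hs
    rw [mem_filter, HasAntidiagonal.mem_antidiagonal]
    refine ⟨add_tsub_cancel_of_le fun i => ?_, fun i => ?_⟩
    · rw [hind]
      split_ifs with hi
      · exact Nat.one_le_iff_ne_zero.2 (Finsupp.mem_support_iff.1 (hs hi))
      · exact Nat.zero_le _
    · simp only [hind]
      split_ifs <;> simp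
  · intro p hp
    rw [mem_filter, HasAntidiagonal.mem_antidiagonal] at hp
    rw [mem_powerset, ← hp.1]
    intro i hi
    simp only [Finsupp.mem_support_iff, Finsupp.add_apply] at hi ⊢
    omega
  · intro s hs
    ext i
    rw [Finsupp.mem_support_iff, hind]
    simp
  · intro p hp
    rw [mem_filter, HasAntidiagonal.mem_antidiagonal] at hp
    have h1 : ∑ i ∈ p.1.support, Finsupp.single i 1 = p.1 := by
      ext i
      rw [hind]
      have := hp.2 i
      by_cases hi : p.1 i = 0
      · simp [hi]
      · rw [if_pos (Finsupp.mem_support_iff.2 hi)]; omega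
    rw [Prod.ext_iff]
    refine ⟨h1, ?_⟩
    simp only [h1]
    rw [← hp.1, add_tsub_cancel_left]
  · intro s hs
    rw [map_sum]
    simp

/-- This is `E(-t) H(t) = 1`. The coefficient of `x^d` is the signed count of squarefree divisors of
`x^d`. -/
theorem sum_antidiagonal_e_mul_h {k : ℕ} (hk : k ≠ 0) :
    ∑ p ∈ antidiagonal k, (-1 : Sym R) ^ p.1 * (e R p.1 * h R p.2) = 0 := by
  classical
  apply Subtype.ext
  ext d
  have hsign : ∀ j : ℕ, ((-1 : Sym R) ^ j : Sym R) = algebraMap R (Sym R) ((-1) ^ j) := fun j => by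
    simp
  -- With the signs as scalars from `R`, taking coefficients passes through them.
  simp only [hsign, ← Algebra.smul_def]
  rw [AddSubmonoidClass.coe_finsetSum, map_sum]
  have hterm : ∀ p ∈ antidiagonal k, coeff d (((-1 : R) ^ p.1 • (e R p.1 * h R p.2) : Sym R) :
      MvPowerSeries ℕ R) = ∑ x ∈ antidiagonal d,
        if p = (x.1.degree, x.2.degree) then
          (if ∀ i, x.1 i ≤ 1 then (-1 : R) ^ x.1.degree else 0) else 0 := by
    intro p _
    rw [Subalgebra.coe_smul, coeff_smul, Subalgebra.coe_mul, coeff_mul, mul_sum]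
    refine sum_congr rfl fun x _ => ?_
    rw [coeff_e, coeff_h]
    obtain ⟨i, j⟩ := p
    by_cases h1 : i = x.1.degree <;> by_cases h2 : j = x.2.degree <;>
      simp [h1, h2, eq_comm]
  rw [sum_congr rfl hterm, sum_comm]
  simp only [sum_ite_eq', HasAntidiagonal.mem_antidiagonal]
  rw [ZeroMemClass.coe_zero, map_zero]
  have hdeg : ∀ x ∈ antidiagonal d, x.1.degree + x.2.degree = d.degree := fun x hx => by
    rw [← map_add, HasAntidiagonal.mem_antidiagonal.1 hx]
  by_cases hd : d.degree = k
  · rw [sum_congr rfl fun x hx => if_pos ((hdeg x hx).trans hd)]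
    exact sum_le_one_neg_one_pow R d fun h => hk (by rw [← hd, h, map_zero])
  · exact sum_eq_zero fun x hx => if_neg fun h => hd ((hdeg x hx).symm.trans h)

end CommRing

/-- If `∑ (-1)^i a_i b_{k-i} = 0` for all `k > 0` and `a_0 = 1`, then `b` is determined by `a`. -/
theorem eq_of_sum_antidiagonal_eq_zero {B : Type*} [Ring B] {a b b' : ℕ → B} (ha : a 0 = 1)
    (h0 : b 0 = b' 0)
    (hb : ∀ k, k ≠ 0 → ∑ p ∈ antidiagonal k, (-1 : B) ^ p.1 * (a p.1 * b p.2) = 0)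
    (hb' : ∀ k, k ≠ 0 → ∑ p ∈ antidiagonal k, (-1 : B) ^ p.1 * (a p.1 * b' p.2) = 0) (k : ℕ) :
    b k = b' k := by
  induction k using Nat.strong_induction_on with
  | _ k ih =>
    rcases k with _ | k
    · exact h0
    · have h1 := (hb (k + 1) k.succ_ne_zero).trans (hb' (k + 1) k.succ_ne_zero).symm
      rw [Nat.antidiagonal_succ, sum_cons, sum_cons] at h1
      simp only [pow_zero, ha, one_mul, sum_map, Function.Embedding.coe_prodMap,
        Function.Embedding.coeFn_mk, Prod.map_fst, Prod.map_snd, Function.Embedding.refl_apply] at h1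
      rw [sum_congr rfl fun p hp => by
        rw [ih p.2 (by have := HasAntidiagonal.mem_antidiagonal.1 hp; omega)]] at h1
      exact add_right_cancel h1

/-- Multiplying by `(-1)^k` turns the sign `(-1)^i` into `(-1)^{k-i}`, so in a commutative ring the
relation is symmetric in the two sequences. -/
theorem neg_one_pow_mul_antidiagonal_swap {B : Type*} [CommRing B] {a b : ℕ → B} {k : ℕ}
    (h : ∑ p ∈ antidiagonal k, (-1 : B) ^ p.1 * (a p.1 * b p.2) = 0) :
    ∑ p ∈ antidiagonal k, (-1 : B) ^ p.1 * (b p.1 * a p.2) = 0 := by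
  rw [← Nat.sum_antidiagonal_swap] at h
  have h1 := congrArg (fun z => (-1 : B) ^ k * z) h
  simp only [mul_sum, mul_zero] at h1
  rw [← h1]
  refine sum_congr rfl fun p hp => ?_
  rw [← HasAntidiagonal.mem_antidiagonal.1 hp, pow_add]
  simp only [Prod.fst_swap, Prod.snd_swap]
  have : (-1 : B) ^ p.2 * (-1) ^ p.2 = 1 := by rw [← mul_pow]; simp
  linear_combination (-(-1 : B) ^ p.1 * (b p.1 * a p.2)) * this

section CommRing

variable (R : Type*) [CommRing R]

theorem omega_e_eq_h (k : ℕ) : omega R (e R k) = h R k := by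
  rcases k with _ | k
  · rw [e_zero, h_zero, map_one]
  · exact omega_e R k

/-- Applying `ω` to `E(-t) H(t) = 1` shows that the `ω(h_k)` satisfy the recursion over the `h_k`
that determines the `e_k`. -/
theorem omega_h (k : ℕ) : omega R (h R k) = e R k := by
  refine eq_of_sum_antidiagonal_eq_zero (a := h R) (b := fun k => omega R (h R k)) (h_zero R)
    (by rw [h_zero, e_zero, map_one]) (fun k hk => ?_) (fun k hk => ?_) k
  · have := congrArg (omega R) (sum_antidiagonal_e_mul_h R hk)
    simpa only [map_sum, map_mul, map_pow, map_neg, map_one, omega_e_eq_h, map_zero] using this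
  · exact neg_one_pow_mul_antidiagonal_swap (sum_antidiagonal_e_mul_h R hk)

theorem omega_omega (f : Sym R) : omega R (omega R f) = f := by
  obtain ⟨p, rfl⟩ := (eHom_bijective R).2 f
  have : ((omega R).comp (omega R)).comp (eHom R) = eHom R := by
    refine MvPolynomial.algHom_ext fun i => ?_
    simp [eHom, omega_e_eq_h, omega_h]
  exact AlgHom.congr_fun this p

end CommRing

end SymFn

/-! ### Monomial expansions, the dual Cauchy identity, independence of the forgotten functions. -/

namespace SymFn

open MvPowerSeries Finset

/-- For `v > 0` both fibres have as many elements as `v` has occurrences in the common multiset. For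
`v = 0` both are complements of finite sets, hence countably infinite. -/
theorem nonempty_equiv_fiber {c d : ℕ →₀ ℕ} (h : c.support.val.map c = d.support.val.map d)
    (v : ℕ) : Nonempty ({i // c i = v} ≃ {i // d i = v}) := by
  classical
  rcases Nat.eq_zero_or_pos v with rfl | hv
  · have inf : ∀ f : ℕ →₀ ℕ, Infinite {i // f i = 0} := fun f => by
      have hs : {i | f i = 0} = (f.support : Set ℕ)ᶜ := by ext; simp
      have hinf : {i | f i = 0}.Infinite := hs ▸ (finite_toSet f.support).infinite_compl
      exact hinf.to_subtype
    have := inf c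
    have := inf d
    exact nonempty_equiv_of_countable
  · have key : ∀ f : ℕ →₀ ℕ, Multiset.count v (f.support.val.map f) = #{i ∈ f.support | f i = v} :=
      fun f => by
        rw [Multiset.count_map]
        simp only [eq_comm]
        rfl
    have hcard : #{i ∈ c.support | c i = v} = #{i ∈ d.support | d i = v} := by
      rw [← key, ← key, h]
    have sub : ∀ f : ℕ →₀ ℕ, ∀ i, f i = v ↔ i ∈ ({i ∈ f.support | f i = v} : Finset ℕ) :=
      fun f i => by
        simp only [mem_filter, Finsupp.mem_support_iff]
        constructor
        · intro hi; exact ⟨by omega, hi⟩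
        · exact fun hi => hi.2
    exact ⟨((Equiv.subtypeEquivRight (sub c)).trans (equivOfCardEq hcard)).trans
      (Equiv.subtypeEquivRight (sub d)).symm⟩

/-- Two exponent vectors with the same nonzero exponents differ by a permutation of the variables. -/
theorem exists_embDomain_eq {c d : ℕ →₀ ℕ} (h : c.support.val.map c = d.support.val.map d) :
    ∃ σ : Equiv.Perm ℕ, c.embDomain σ.toEmbedding = d := by
  let E := fun v => (nonempty_equiv_fiber h v).some
  let σ : Equiv.Perm ℕ := (Equiv.sigmaFiberEquiv c).symm.trans
    ((Equiv.sigmaCongrRight fun v => E v).trans (Equiv.sigmaFiberEquiv d))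
  have hσ : ∀ i, d (σ i) = c i := fun i => (E (c i) ⟨i, rfl⟩).2
  refine ⟨σ, ?_⟩
  ext j
  obtain ⟨i, rfl⟩ := σ.surjective j
  rw [hσ]
  exact Finsupp.embDomain_apply_self σ.toEmbedding c i

theorem coeff_eq_of_map_eq {R : Type*} [CommRing R] (f : Sym R) {c d : ℕ →₀ ℕ}
    (h : c.support.val.map c = d.support.val.map d) :
    coeff c (f : MvPowerSeries ℕ R) = coeff d (f : MvPowerSeries ℕ R) := by
  obtain ⟨σ, rfl⟩ := exists_embDomain_eq h
  exact (coeff_embDomain_of_mem_Sym f.2 σ c).symm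

/-- The shape of an exponent vector. -/
def shape (d : ℕ →₀ ℕ) : d.degree.Partition where
  parts := d.support.val.map d
  parts_pos := by
    intro i hi
    obtain ⟨j, hj, rfl⟩ := Multiset.mem_map.1 hi
    exact Nat.pos_of_ne_zero (Finsupp.mem_support_iff.1 hj)
  parts_sum := rfl

theorem exists_shape (s : Multiset ℕ) (hs : 0 ∉ s) :
    ∃ d : ℕ →₀ ℕ, d.support.val.map d = s := by
  classical
  induction s using Multiset.induction with
  | empty => exact ⟨0, rfl⟩
  | cons a s ih =>
    obtain ⟨d, rfl⟩ := ih fun h => hs (Multiset.mem_cons_of_mem h)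
    have ha : a ≠ 0 := fun h => hs (h ▸ Multiset.mem_cons_self _ _)
    obtain ⟨i, hi⟩ := Infinite.exists_notMem_finset d.support
    have hsupp : (d.update i a).support = insert i d.support := by
      rw [Finsupp.support_update_ne_zero _ _ ha]
    refine ⟨d.update i a, ?_⟩
    rw [hsupp, insert_val_of_notMem hi, Multiset.map_cons]
    congr 1
    · simp
    · refine Multiset.map_congr rfl fun j hj => ?_
      have : j ≠ i := fun h => hi (h ▸ hj)
      simp [Finsupp.coe_update, this]

/-- An exponent vector whose nonzero exponents are the parts of `ν`. -/
noncomputable def expo {k : ℕ} (ν : k.Partition) : ℕ →₀ ℕ :=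
  (exists_shape ν.parts fun h => (ν.parts_pos h).ne rfl).choose

theorem map_expo {k : ℕ} (ν : k.Partition) : (expo ν).support.val.map (expo ν) = ν.parts :=
  (exists_shape ν.parts fun h => (ν.parts_pos h).ne rfl).choose_spec

theorem degree_expo {k : ℕ} (ν : k.Partition) : (expo ν).degree = k := by
  exact (congrArg Multiset.sum (map_expo ν)).trans ν.parts_sum

section CommRing

variable (R : Type*) [CommRing R]

theorem coeff_m {k : ℕ} (ν : k.Partition) (d : ℕ →₀ ℕ) : coeff d (m R ν : MvPowerSeries ℕ R) =
    if d.support.val.map d = ν.parts then 1 else 0 := rfl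

variable {R}

/-- A homogeneous symmetric function is a combination of monomial symmetric functions. -/
theorem eq_sum_coeff_smul_m (k : ℕ) (f : Sym R)
    (hf : ∀ d : ℕ →₀ ℕ, d.degree ≠ k → coeff d (f : MvPowerSeries ℕ R) = 0) :
    f = ∑ ν : k.Partition, coeff (expo ν) (f : MvPowerSeries ℕ R) • m R ν := by
  apply Subtype.ext
  ext d
  rw [AddSubmonoidClass.coe_finsetSum, map_sum]
  simp only [Subalgebra.coe_smul, coeff_smul, coeff_m]
  by_cases hd : d.degree = k
  · subst hd
    rw [sum_eq_single (shape d)]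
    · rw [show Multiset.map d d.support.val = (shape d).parts from rfl, if_pos rfl, mul_one]
      exact (coeff_eq_of_map_eq f (map_expo (shape d))).symm
    · intro ν _ hν
      rw [if_neg fun h => hν (Nat.Partition.ext h.symm), mul_zero]
    · exact fun h => (h (mem_univ _)).elim
  · rw [hf d hd]
    refine (sum_eq_zero fun ν _ => ?_).symm
    rw [if_neg, mul_zero]
    intro h
    apply hd
    rw [Finsupp.degree_apply, ← ν.parts_sum, ← h]
    rfl

/-- The dual Cauchy identity: `∑_ν f_ν(x) e_ν(y) = ∑_d x^d h_d(y)`. -/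
theorem sum_coeff_forgotten_smul_eProd (k : ℕ) (d : ℕ →₀ ℕ) :
    ∑ ν : k.Partition, coeff d (forgotten R ν : MvPowerSeries ℕ R) • eProd R (expo ν) =
      if d.degree = k then hProd R d else 0 := by
  -- Expanding `e_r` in monomial functions and applying `ω` gives `h_r = ∑_ν [y^ν] e_r · f_ν`; then
  -- the coefficient at `d` is taken.
  have key : ∀ r : ℕ →₀ ℕ, r.degree = k →
      ∑ ν : k.Partition, coeff d (forgotten R ν : MvPowerSeries ℕ R) *
        coeff (expo ν) (eProd R r : MvPowerSeries ℕ R) =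
      coeff d (hProd R r : MvPowerSeries ℕ R) := by
    intro r hr
    have hexp := congrArg (fun f : Sym R => coeff d (omega R f : MvPowerSeries ℕ R))
      (eq_sum_coeff_smul_m k (eProd R r) fun c hc => coeff_eProd_of_degree_ne R (hr.symm ▸ hc))
    simp only [omega_eProd, map_sum, map_smul, AddSubmonoidClass.coe_finsetSum,
      Subalgebra.coe_smul] at hexp
    rw [hexp]
    exact sum_congr rfl fun ν _ => mul_comm _ _
  apply Subtype.ext
  ext r
  rw [AddSubmonoidClass.coe_finsetSum, map_sum]
  simp only [Subalgebra.coe_smul, coeff_smul]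
  by_cases hr : r.degree = k
  -- The transposition symmetry exchanges the index of `e` with the exponent read off, which brings
  -- the sum to the form of `key`.
  · simp only [coeff_eProd_comm R _ r]
    rw [key r hr]
    split_ifs with hd
    · exact coeff_hProd_comm R r d
    · rw [coeff_hProd_of_degree_ne R (hr.symm ▸ hd), ZeroMemClass.coe_zero, map_zero]
  · rw [sum_eq_zero fun ν _ => by
      rw [coeff_eProd_of_degree_ne R (by rwa [degree_expo]), mul_zero]]
    split_ifs with hd
    · rw [coeff_hProd_of_degree_ne R (hd.symm ▸ hr)]
    · rw [ZeroMemClass.coe_zero, map_zero]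

/-- The forgotten symmetric functions are linearly independent. -/
theorem eq_zero_of_sum_forgotten_eq_zero (s : Finset (Σ k : ℕ, k.Partition))
    (a : (Σ k : ℕ, k.Partition) → R)
    (h0 : ∀ d, ∑ ν ∈ s, a ν * coeff d (forgotten R ν.2 : MvPowerSeries ℕ R) = 0) :
    ∀ ν ∈ s, a ν = 0 := by
  intro ν hν
  have h1 : ∑ ν ∈ s, a ν • forgotten R ν.2 = 0 := by
    apply Subtype.ext
    ext d
    rw [AddSubmonoidClass.coe_finsetSum, map_sum, ZeroMemClass.coe_zero, map_zero, ← h0 d]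
    rfl
  -- Since `ω` is an involution, this is a relation among the `m_ν`, and distinct `m_ν` share no
  -- monomial.
  have h2 := congrArg (omega R) h1
  simp only [map_sum, map_smul, forgotten, omega_omega, map_zero] at h2
  have h3 := congrArg (fun f : Sym R => coeff (expo ν.2) (f : MvPowerSeries ℕ R)) h2
  simp only [AddSubmonoidClass.coe_finsetSum, map_sum, Subalgebra.coe_smul, coeff_smul, coeff_m,
    ZeroMemClass.coe_zero, map_zero, map_expo] at h3
  rw [sum_eq_single_of_mem ν hν] at h3
  · simpa using h3
  · rintro ⟨k, ρ⟩ _ hρ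
    rw [if_neg, mul_zero]
    intro h
    apply hρ
    obtain ⟨k', ν⟩ := ν
    obtain rfl : k' = k := (ν.parts_sum.symm.trans (congrArg Multiset.sum h)).trans ρ.parts_sum
    exact congrArg (Sigma.mk _) (Nat.Partition.ext h.symm)

end CommRing

end SymFn

/-! ### Two-colour symmetry for disjoint chains. -/

namespace NatUnitIntervalOrder

open Finset

section Commutation

open scoped Classical

variable {n : ℕ} (P : NatUnitIntervalOrder n)

/-- Any two elements of `K` are comparable in `P`. -/
def IsChainSet (K : Finset (Fin n)) : Prop := ∀ x ∈ K, ∀ y ∈ K, x < y → P.lt x y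

/-- The number of pairs of incomparable elements `y < x` with `x ∈ K` and `y ∈ L`. -/
noncomputable def crossCard (K L : Finset (Fin n)) : ℕ :=
  ∑ x ∈ K, ∑ y ∈ L, if y < x ∧ ¬ P.lt y x then 1 else 0

variable {P}

theorem lt_of_le_of_lt {a b c : Fin n} (hab : a ≤ b) (hbc : P.lt b c) : P.lt a c :=
  (P.monotone_m hab).trans_lt hbc

theorem lt_of_lt_of_le {a b c : Fin n} (hab : P.lt a b) (hbc : b ≤ c) : P.lt a c :=
  LT.lt.trans_le (show P.m a < b from hab) hbc

theorem isChainSet_empty : P.IsChainSet ∅ := by simp [IsChainSet]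

theorem IsChainSet.mono {K L : Finset (Fin n)} (hL : P.IsChainSet L) (h : K ⊆ L) :
    P.IsChainSet K := fun x hx y hy => hL x (h hx) y (h hy)

theorem isChainSet_insert {a : Fin n} {K : Finset (Fin n)} (ha : ∀ x ∈ K, a < x) :
    P.IsChainSet (insert a K) ↔ P.IsChainSet K ∧ ∀ x ∈ K, P.lt a x := by
  constructor
  · intro h
    exact ⟨h.mono (subset_insert _ _), fun x hx =>
      h a (mem_insert_self _ _) x (mem_insert_of_mem hx) (ha x hx)⟩
  · rintro ⟨h1, h2⟩ x hx y hy hxy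
    rcases mem_insert.1 hx with rfl | hx' <;> rcases mem_insert.1 hy with rfl | hy'
    · exact (lt_irrefl _ hxy).elim
    · exact h2 y hy'
    · exact (lt_asymm hxy (ha x hx')).elim
    · exact h1 x hx' y hy' hxy

theorem crossCard_insert_left {a : Fin n} {K L : Finset (Fin n)} (haK : ∀ x ∈ K, a < x)
    (haL : ∀ x ∈ L, a < x) : P.crossCard (insert a K) L = P.crossCard K L := by
  rw [crossCard, sum_insert fun h => lt_irrefl _ (haK a h)]
  rw [sum_eq_zero fun y hy => if_neg fun h => lt_asymm h.1 (haL y hy), zero_add]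
  rfl

theorem crossCard_insert_right {a : Fin n} {K L : Finset (Fin n)} (haK : ∀ x ∈ K, a < x)
    (haL : ∀ x ∈ L, a < x) :
    P.crossCard K (insert a L) = #{x ∈ K | ¬ P.lt a x} + P.crossCard K L := by
  simp only [crossCard]
  rw [card_filter, ← sum_add_distrib]
  refine sum_congr rfl fun x hx => ?_
  rw [sum_insert fun h => lt_irrefl _ (haL a h)]
  congr 1
  simp [haK x hx]

variable (P) {A : Type*} [CommRing A] (q : A)

/-- The contribution of the colouring of `S` with colour classes `C` and `S \ C`. -/
noncomputable def splitWeight (S : Finset (Fin n)) (x y : A) (C : Finset (Fin n)) : A :=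
  if P.IsChainSet C ∧ P.IsChainSet (S \ C) then
    q ^ P.crossCard C (S \ C) * (x ^ #C * y ^ #(S \ C)) else 0

variable {P}

theorem splitWeight_insert_left {a : Fin n} {S C : Finset (Fin n)} (ha : ∀ x ∈ S, a < x)
    (hC : C ⊆ S) (x y : A) : P.splitWeight q (insert a S) x y (insert a C) =
      if ∀ c ∈ C, P.lt a c then x * P.splitWeight q S x y C else 0 := by
  have haS : a ∉ S := fun h => lt_irrefl _ (ha a h)
  have haC : a ∉ C := fun h => haS (hC h)
  have hsd : insert a S \ insert a C = S \ C := by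
    rw [insert_sdiff_insert, sdiff_insert_of_notMem haS]
  rw [splitWeight, splitWeight, hsd, isChainSet_insert fun x hx => ha x (hC hx),
    crossCard_insert_left (fun x hx => ha x (hC hx)) (fun x hx => ha x (sdiff_subset hx)),
    card_insert_of_notMem haC]
  by_cases h3 : ∀ c ∈ C, P.lt a c
  · rw [if_pos h3]
    by_cases h12 : P.IsChainSet C ∧ P.IsChainSet (S \ C)
    · rw [if_pos ⟨⟨h12.1, h3⟩, h12.2⟩, if_pos h12]; ring
    · rw [if_neg fun h => h12 ⟨h.1.1, h.2⟩, if_neg h12, mul_zero]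
  · rw [if_neg h3, if_neg fun h => h3 h.1.2]

/-- Crossing pairs have their larger element in the first class. A new least element therefore
creates such pairs only when it joins the second class, and this asymmetry is the source of the
powers of `q`. -/
theorem splitWeight_insert_right {a : Fin n} {S C : Finset (Fin n)} (ha : ∀ x ∈ S, a < x)
    (hC : C ⊆ S) (x y : A) : P.splitWeight q (insert a S) x y C =
      if ∀ c ∈ S \ C, P.lt a c then
        y * q ^ #{c ∈ C | ¬ P.lt a c} * P.splitWeight q S x y C else 0 := by
  have haS : a ∉ S := fun h => lt_irrefl _ (ha a h)
  have haC : a ∉ C := fun h => haS (hC h)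
  have hsd : insert a S \ C = insert a (S \ C) := insert_sdiff_of_notMem _ haC
  have haD : a ∉ S \ C := fun h => haS (sdiff_subset h)
  rw [splitWeight, splitWeight, hsd, isChainSet_insert fun x hx => ha x (sdiff_subset hx),
    crossCard_insert_right (fun x hx => ha x (hC hx)) (fun x hx => ha x (sdiff_subset hx)),
    card_insert_of_notMem haD]
  by_cases h3 : ∀ c ∈ S \ C, P.lt a c
  · rw [if_pos h3]
    by_cases h12 : P.IsChainSet C ∧ P.IsChainSet (S \ C)
    · rw [if_pos ⟨h12.1, h12.2, h3⟩, if_pos h12]; ring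
    · rw [if_neg fun h => h12 ⟨h.1, h.2.1⟩, if_neg h12, mul_zero]
  · rw [if_neg h3, if_neg fun h => h3 h.2.2]

/-- By monotonicity of `m`, if `a < b < c` and `a`, `c` are incomparable, then all three are
pairwise incomparable, and two chains cannot contain them. -/
theorem splitWeight_eq_zero {a b c : Fin n} {S C : Finset (Fin n)} (ha : ∀ x ∈ S, a < x)
    (hb : b ∈ S) (hc : c ∈ S) (hbc : b < c) (hac : ¬ P.lt a c) (x y : A) :
    P.splitWeight q (insert a S) x y C = 0 := by
  have hab : ¬ P.lt a b := fun h => hac (lt_of_lt_of_le h hbc.le)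
  have hbc' : ¬ P.lt b c := fun h => hac (lt_of_le_of_lt (ha b hb).le h)
  rw [splitWeight, if_neg]
  rintro ⟨h1, h2⟩
  have h2' : ∀ x ∈ insert a S, x ∉ C → ∀ y ∈ insert a S, y ∉ C → x < y → P.lt x y :=
    fun x hx hx' y hy hy' => h2 x (mem_sdiff.2 ⟨hx, hx'⟩) y (mem_sdiff.2 ⟨hy, hy'⟩)
  have ia := mem_insert_self a S
  have ib := mem_insert_of_mem (b := a) hb
  have ic := mem_insert_of_mem (b := a) hc
  by_cases ka : a ∈ C <;> by_cases kb : b ∈ C <;> by_cases kc : c ∈ C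
  · exact hab (h1 a ka b kb (ha b hb))
  · exact hab (h1 a ka b kb (ha b hb))
  · exact hac (h1 a ka c kc (ha c hc))
  · exact hbc' (h2' b ib kb c ic kc hbc)
  · exact hbc' (h1 b kb c kc hbc)
  · exact hac (h2' a ia ka c ic kc (ha c hc))
  · exact hab (h2' a ia ka b ib kb (ha b hb))
  · exact hab (h2' a ia ka b ib kb (ha b hb))

theorem sum_powerset_insert_mem {S : Finset (Fin n)} {a : Fin n} (ha : a ∉ S)
    (f : Finset (Fin n) → A) :
    ∑ C ∈ (insert a S).powerset with a ∈ C, f C = ∑ C ∈ S.powerset, f (insert a C) := by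
  rw [sum_filter, sum_powerset_insert ha]
  rw [sum_eq_zero fun C hC => if_neg fun h => ha (mem_powerset.1 hC h), zero_add]
  exact sum_congr rfl fun C _ => if_pos (mem_insert_self _ _)

theorem sum_powerset_insert_notMem {S : Finset (Fin n)} {a : Fin n} (ha : a ∉ S)
    (f : Finset (Fin n) → A) :
    ∑ C ∈ (insert a S).powerset with a ∉ C, f C = ∑ C ∈ S.powerset, f C := by
  rw [sum_filter, sum_powerset_insert ha]
  rw [sum_eq_zero (s := S.powerset) (f := fun C => if a ∉ insert a C then f (insert a C) else 0)
    fun C _ => if_neg fun h => h (mem_insert_self _ _), add_zero]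
  exact sum_congr rfl fun C hC => if_pos fun h => ha (mem_powerset.1 hC h)

/-- The two possible shapes of the generating functions of the colourings in which the least
element of `S` gets the first or the second colour, according to whether the component of the least
element in the incomparability graph has odd or even size. -/
theorem exists_symm_splitWeight (S : Finset (Fin n)) : ∀ a ∈ S, (∀ b ∈ S, a ≤ b) →
    ∃ Y : A → A → A, (∀ x y, Y x y = Y y x) ∧
      ((∀ x y, ∑ C ∈ S.powerset with a ∈ C, P.splitWeight q S x y C = x * Y x y ∧
          ∑ C ∈ S.powerset with a ∉ C, P.splitWeight q S x y C = y * Y x y) ∨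
        ∀ x y, ∑ C ∈ S.powerset with a ∈ C, P.splitWeight q S x y C = x * y * Y x y ∧
          ∑ C ∈ S.powerset with a ∉ C, P.splitWeight q S x y C = q * (x * y * Y x y)) := by
  induction S using Finset.induction_on_min with
  | empty => intro a ha; simp at ha
  | insert a S haS ih =>
    intro a' ha' hmin
    obtain rfl : a' = a := by
      rcases mem_insert.1 ha' with h | h
      · exact h
      · exact (lt_irrefl _ ((haS a' h).trans_le (hmin a (mem_insert_self _ _)))).elim
    have ha : a' ∉ S := fun h => lt_irrefl _ (haS a' h)
    have hL : ∀ x y : A, ∑ C ∈ (insert a' S).powerset with a' ∈ C,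
        P.splitWeight q (insert a' S) x y C =
        ∑ C ∈ S.powerset, if ∀ c ∈ C, P.lt a' c then x * P.splitWeight q S x y C else 0 := by
      intro x y
      rw [sum_powerset_insert_mem ha]
      exact sum_congr rfl fun C hC => splitWeight_insert_left q haS (mem_powerset.1 hC) x y
    have hR : ∀ x y : A, ∑ C ∈ (insert a' S).powerset with a' ∉ C,
        P.splitWeight q (insert a' S) x y C = ∑ C ∈ S.powerset, if ∀ c ∈ S \ C, P.lt a' c then
          y * q ^ #{c ∈ C | ¬ P.lt a' c} * P.splitWeight q S x y C else 0 := by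
      intro x y
      rw [sum_powerset_insert_notMem ha]
      exact sum_congr rfl fun C hC => splitWeight_insert_right q haS (mem_powerset.1 hC) x y
    rcases S.eq_empty_or_nonempty with rfl | hne
    · refine ⟨fun _ _ => 1, fun _ _ => rfl, Or.inl fun x y => ?_⟩
      rw [hL, hR]
      simp [splitWeight, isChainSet_empty, crossCard]
    have hbS := S.min'_mem hne
    set b := S.min' hne with hbdef
    have hbmin : ∀ c ∈ S, b ≤ c := fun c hc => S.min'_le c hc
    obtain ⟨Y, hY, hcase⟩ := ih b hbS hbmin
    have hsplit : ∀ x y : A, ∑ C ∈ S.powerset, P.splitWeight q S x y C =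
        ∑ C ∈ S.powerset with b ∈ C, P.splitWeight q S x y C +
        ∑ C ∈ S.powerset with b ∉ C, P.splitWeight q S x y C := fun x y =>
      (sum_filter_add_sum_filter_not _ _ _).symm
    -- If `a'` lies below `b` in `P`, it lies below all of `S`. It is then an isolated vertex
    -- contributing only the factor `x` or `y`, and the remaining factor is symmetric by either
    -- shape of the induction hypothesis.
    by_cases hab : P.lt a' b
    · have hall : ∀ c ∈ S, P.lt a' c := fun c hc => lt_of_lt_of_le hab (hbmin c hc)
      refine ⟨fun x y => ∑ C ∈ S.powerset, P.splitWeight q S x y C, fun x y => ?_,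
        Or.inl fun x y => ⟨?_, ?_⟩⟩
      · beta_reduce
        rw [hsplit, hsplit]
        rcases hcase with hc | hc
        · rw [(hc x y).1, (hc x y).2, (hc y x).1, (hc y x).2, hY y x]; ring
        · rw [(hc x y).1, (hc x y).2, (hc y x).1, (hc y x).2, hY y x]; ring
      · rw [hL, mul_sum]
        exact sum_congr rfl fun C hC => if_pos fun c hc => hall c (mem_powerset.1 hC hc)
      · rw [hR, mul_sum]
        refine sum_congr rfl fun C hC => ?_
        rw [if_pos fun c hc => hall c (sdiff_subset hc),
          filter_false_of_mem fun c hc => not_not.2 (hall c (mem_powerset.1 hC hc))]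
        simp
    · by_cases hex : ∃ c ∈ S, b < c ∧ ¬ P.lt a' c
      · obtain ⟨c, hc, hbc, hac⟩ := hex
        refine ⟨fun _ _ => 0, fun _ _ => rfl, Or.inl fun x y => ?_⟩
        simp only [splitWeight_eq_zero q haS hbS hc hbc hac, sum_const_zero, mul_zero, and_self]
      · push Not at hex
        -- Here `b` is the only element of `S` incomparable to `a'`, so `a'` gets the colour that
        -- `b` does not have. If `a'` is in the second class, the pair `a' < b` adds one factor `q`.
        -- This exchanges the odd and the even shape.
        have hiff : ∀ c ∈ S, P.lt a' c ↔ c ≠ b := fun c hc =>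
          ⟨fun h hcb => hab (hcb ▸ h), fun h => hex c hc (lt_of_le_of_ne (hbmin c hc) h.symm)⟩
        have hL' : ∀ x y : A, ∑ C ∈ (insert a' S).powerset with a' ∈ C,
            P.splitWeight q (insert a' S) x y C =
            x * ∑ C ∈ S.powerset with b ∉ C, P.splitWeight q S x y C := by
          intro x y
          rw [hL, mul_sum, sum_filter]
          refine sum_congr rfl fun C hC => if_congr ?_ rfl rfl
          have hCS := mem_powerset.1 hC
          exact ⟨fun h hb => hab (h b hb), fun h c hc => (hiff c (hCS hc)).2 fun hcb => h (hcb ▸ hc)⟩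
        have hR' : ∀ x y : A, ∑ C ∈ (insert a' S).powerset with a' ∉ C,
            P.splitWeight q (insert a' S) x y C =
            y * q * ∑ C ∈ S.powerset with b ∈ C, P.splitWeight q S x y C := by
          intro x y
          rw [hR, mul_sum, sum_filter]
          refine sum_congr rfl fun C hC => ?_
          have hCS := mem_powerset.1 hC
          by_cases hbC : b ∈ C
          · have h1 : ({c ∈ C | ¬ P.lt a' c} : Finset (Fin n)) = {b} := by
              ext c
              rw [mem_filter, mem_singleton]
              constructor
              · rintro ⟨h1, h2⟩
                by_contra h3
                exact h2 ((hiff c (hCS h1)).2 h3)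
              · rintro rfl
                exact ⟨hbC, hab⟩
            rw [if_pos hbC, if_pos, h1, card_singleton, pow_one]
            intro c hc
            rw [mem_sdiff] at hc
            exact (hiff c hc.1).2 fun hcb => hc.2 (hcb ▸ hbC)
          · rw [if_neg hbC, if_neg]
            exact fun h => hab (h b (mem_sdiff.2 ⟨hbS, hbC⟩))
        rcases hcase with hc | hc
        · refine ⟨Y, hY, Or.inr fun x y => ?_⟩
          rw [hL', hR', (hc x y).1, (hc x y).2]
          constructor <;> ring
        · refine ⟨fun x y => q * x * y * Y x y, fun x y => by beta_reduce; rw [hY]; ring, Or.inl fun x y => ?_⟩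
          rw [hL', hR', (hc x y).1, (hc x y).2]
          constructor <;> ring

/-- The two shapes add up to `(x + y) Y` and `(1 + q) x y Y`, which are symmetric whenever `Y` is.
-/
theorem sum_splitWeight_symm (S : Finset (Fin n)) (x y : A) :
    ∑ C ∈ S.powerset, P.splitWeight q S x y C = ∑ C ∈ S.powerset, P.splitWeight q S y x C := by
  rcases S.eq_empty_or_nonempty with rfl | hne
  · simp [splitWeight]
  · have hsplit : ∀ x y : A, ∑ C ∈ S.powerset, P.splitWeight q S x y C =
        ∑ C ∈ S.powerset with S.min' hne ∈ C, P.splitWeight q S x y C +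
        ∑ C ∈ S.powerset with S.min' hne ∉ C, P.splitWeight q S x y C := fun x y =>
      (sum_filter_add_sum_filter_not _ _ _).symm
    obtain ⟨Y, hY, hc | hc⟩ := exists_symm_splitWeight (P := P) q S _ (S.min'_mem hne)
      fun b hb => S.min'_le b hb
    · rw [hsplit, hsplit, (hc x y).1, (hc x y).2, (hc y x).1, (hc y x).2, hY y x]; ring
    · rw [hsplit, hsplit, (hc x y).1, (hc x y).2, (hc y x).1, (hc y x).2, hY y x]; ring

end Commutation

end NatUnitIntervalOrder

/-! ### Commutation for pairs of chains that may overlap. -/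

namespace NatUnitIntervalOrder

open Finset

section Commutation

open scoped Classical

variable {n : ℕ} {P : NatUnitIntervalOrder n} {A : Type*} [CommRing A] (q : A)

theorem isChainSet_union_iff {T C U : Finset (Fin n)} (hCU : C ⊆ U)
    (hT : ∀ t ∈ T, ∀ s ∈ U, (t < s → P.lt t s) ∧ (s < t → P.lt s t)) (hTT : P.IsChainSet T) :
    P.IsChainSet (T ∪ C) ↔ P.IsChainSet C := by
  refine ⟨fun h => h.mono subset_union_right, fun h x hx y hy hxy => ?_⟩
  rcases mem_union.1 hx with hx | hx <;> rcases mem_union.1 hy with hy | hy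
  · exact hTT x hx y hy hxy
  · exact (hT x hx y (hCU hy)).1 hxy
  · exact (hT y hy x (hCU hx)).2 hxy
  · exact h x hx y hy hxy

/-- A crossing pair is incomparable, so elements comparable to everything in sight take part in
none. -/
theorem crossCard_union_union {T C D : Finset (Fin n)} (hTC : Disjoint T C) (hTD : Disjoint T D)
    (hT : ∀ t ∈ T, ∀ s ∈ C ∪ D, (t < s → P.lt t s) ∧ (s < t → P.lt s t))
    (hTT : P.IsChainSet T) : P.crossCard (T ∪ C) (T ∪ D) = P.crossCard C D := by
  have h1 : ∀ x ∈ T, ∑ y ∈ T ∪ D, (if y < x ∧ ¬ P.lt y x then 1 else 0) = 0 := by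
    intro x hx
    refine sum_eq_zero fun y hy => if_neg fun h => h.2 ?_
    rcases mem_union.1 hy with hy | hy
    · exact hTT y hy x hx h.1
    · exact (hT x hx y (mem_union_right _ hy)).2 h.1
  rw [crossCard, sum_union hTC, sum_eq_zero h1, zero_add, crossCard]
  refine sum_congr rfl fun x hx => ?_
  rw [sum_union hTD, sum_eq_zero fun y hy => if_neg fun h =>
    h.2 ((hT y hy x (mem_union_left _ hx)).1 h.1), zero_add]

theorem val_union_add_val_union {T S C : Finset (Fin n)} (hTS : Disjoint T S) (hC : C ⊆ S) :
    (T ∪ C).val + (T ∪ S \ C).val = T.val + T.val + S.val := by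
  rw [← disjUnion_eq_union T C (hTS.mono_right hC),
    ← disjUnion_eq_union T (S \ C) (hTS.mono_right sdiff_subset), disjUnion_val, disjUnion_val]
  have : C.val + (S \ C).val = S.val := by
    rw [← disjUnion_val C (S \ C) disjoint_sdiff, disjUnion_eq_union, union_sdiff_of_subset hC]
  rw [← this]
  abel

/-- The sum over all pairs of chains with given intersection and symmetric difference. -/
theorem sum_pairs_fiber (G : Multiset (Fin n) → A) (x y : A) (T S : Finset (Fin n)) :
    ∑ p : Finset (Fin n) × Finset (Fin n) with (p.1 ∩ p.2, symmDiff p.1 p.2) = (T, S),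
      (if P.IsChainSet p.1 ∧ P.IsChainSet p.2 then
        q ^ P.crossCard p.1 p.2 * (x ^ #p.1 * y ^ #p.2) * G (p.1.val + p.2.val) else 0) =
    (if Disjoint T S ∧ P.IsChainSet T ∧
        ∀ t ∈ T, ∀ s ∈ S, (t < s → P.lt t s) ∧ (s < t → P.lt s t) then 1 else 0) *
      ((x * y) ^ #T * G (T.val + T.val + S.val)) *
        ∑ C ∈ S.powerset, P.splitWeight q S x y C := by
  -- The intersection of two chains is a chain, each element of which is comparable to all elements
  -- of both. If `T` and `S` violate this or meet, every term is zero; otherwise the pairs in the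
  -- fibre are `(T ∪ C, T ∪ S \ C)`.
  by_cases hcond : Disjoint T S ∧ P.IsChainSet T ∧
        ∀ t ∈ T, ∀ s ∈ S, (t < s → P.lt t s) ∧ (s < t → P.lt s t)
  · rw [if_pos hcond, one_mul, mul_sum]
    obtain ⟨hTS, hTT, hT⟩ := hcond
    symm
    refine sum_bij' (fun C _ => (T ∪ C, T ∪ S \ C)) (fun p _ => p.1 \ T) ?_ ?_ ?_ ?_ ?_
    · intro C hC
      rw [mem_powerset] at hC
      rw [mem_filter, Prod.mk_inj]
      refine ⟨mem_univ _, ?_, ?_⟩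
      · ext i
        have h0 : i ∈ T → i ∉ S := fun h => disjoint_left.1 hTS h
        have h1 : i ∈ C → i ∈ S := fun h => hC h
        simp only [mem_inter, mem_union, mem_sdiff]
        tauto
      · ext i
        have h0 : i ∈ T → i ∉ S := fun h => disjoint_left.1 hTS h
        have h1 : i ∈ C → i ∈ S := fun h => hC h
        simp only [mem_symmDiff, mem_union, mem_sdiff]
        tauto
    · intro p hp
      rw [mem_filter, Prod.mk_inj] at hp
      obtain ⟨_, rfl, rfl⟩ := hp
      rw [mem_powerset]
      intro i
      simp only [mem_symmDiff, mem_inter, mem_sdiff]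
      tauto
    · intro C hC
      rw [mem_powerset] at hC
      ext i
      have h0 : i ∈ T → i ∉ S := fun h => disjoint_left.1 hTS h
      have h1 : i ∈ C → i ∈ S := fun h => hC h
      simp only [mem_union, mem_sdiff]
      tauto
    · intro p hp
      rw [mem_filter, Prod.mk_inj] at hp
      obtain ⟨_, rfl, rfl⟩ := hp
      rw [Prod.ext_iff]
      constructor <;> ext i <;> simp only [mem_symmDiff, mem_inter, mem_sdiff, mem_union] <;> tauto
    · intro C hC
      rw [mem_powerset] at hC
      have hTC := hTS.mono_right hC
      have hTD : Disjoint T (S \ C) := hTS.mono_right sdiff_subset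
      simp only
      rw [isChainSet_union_iff hC hT hTT, isChainSet_union_iff (C := S \ C) sdiff_subset hT hTT,
        crossCard_union_union hTC hTD (by rwa [union_sdiff_of_subset hC]) hTT,
        val_union_add_val_union hTS hC, card_union_of_disjoint hTC, card_union_of_disjoint hTD,
        splitWeight]
      split_ifs
      · ring
      · rw [mul_zero]
  · rw [if_neg hcond, zero_mul, zero_mul]
    refine sum_eq_zero fun p hp => if_neg fun h => hcond ?_
    rw [mem_filter, Prod.mk_inj] at hp
    obtain ⟨_, rfl, rfl⟩ := hp
    refine ⟨?_, h.1.mono inter_subset_left, fun t ht s hs => ?_⟩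
    · rw [disjoint_left]
      intro i
      simp only [mem_symmDiff, mem_inter]
      tauto
    · rw [mem_inter] at ht
      rcases mem_symmDiff.1 hs with hs | hs
      · exact ⟨h.1 t ht.1 s hs.1, h.1 s hs.1 t ht.1⟩
      · exact ⟨h.2 t ht.2 s hs.1, h.2 s hs.1 t ht.2⟩

/-- For fixed intersection and symmetric difference the argument of `G` is constant, the common part
contributes a power of `x y`, and the rest is the disjoint case. An arbitrary `G` of the joint
content is allowed so that it can carry the effect of the surrounding letters of a word. -/
theorem sum_pairs_symm (G : Multiset (Fin n) → A) (x y : A) :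
    ∑ p : Finset (Fin n) × Finset (Fin n), (if P.IsChainSet p.1 ∧ P.IsChainSet p.2 then
      q ^ P.crossCard p.1 p.2 * (x ^ #p.1 * y ^ #p.2) * G (p.1.val + p.2.val) else 0) =
    ∑ p : Finset (Fin n) × Finset (Fin n), (if P.IsChainSet p.1 ∧ P.IsChainSet p.2 then
      q ^ P.crossCard p.1 p.2 * (y ^ #p.1 * x ^ #p.2) * G (p.1.val + p.2.val) else 0) := by
  refine (sum_fiberwise _ (fun p => (p.1 ∩ p.2, symmDiff p.1 p.2)) _).symm.trans
    (Eq.trans ?_ (sum_fiberwise _ (fun p => (p.1 ∩ p.2, symmDiff p.1 p.2)) _))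
  refine sum_congr rfl fun t _ => ?_
  obtain ⟨T, S⟩ := t
  rw [sum_pairs_fiber, sum_pairs_fiber, sum_splitWeight_symm, mul_comm x y]

open Polynomial in
/-- The number of pairs of chains with given sizes, counted by the `q`-power of the number of
incomparable inversions between them, does not depend on the order of the sizes. -/
theorem sum_chains_comm (G : Multiset (Fin n) → A) (a b : ℕ) :
    ∑ K : Finset (Fin n) with P.IsChainSet K ∧ #K = a,
      ∑ L : Finset (Fin n) with P.IsChainSet L ∧ #L = b,
        q ^ P.crossCard K L * G (K.val + L.val) =
    ∑ K : Finset (Fin n) with P.IsChainSet K ∧ #K = b,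
      ∑ L : Finset (Fin n) with P.IsChainSet L ∧ #L = a,
        q ^ P.crossCard K L * G (K.val + L.val) := by
  -- With two polynomial variables for `x` and `y`, the coefficient at `a` in the outer and `b` in
  -- the inner variable isolates the pairs of chains of the prescribed sizes.
  have key := sum_pairs_symm (P := P) (A := A[X][X]) (C (C q)) (fun m => C (C (G m))) X (C X)
  have key2 := congrArg (fun f : A[X][X] => (f.coeff a).coeff b) key
  have hco : ∀ (u v i j : ℕ) (r s : A),
      ((C (C r) ^ u * (X ^ i * C X ^ j) * C (C s) : A[X][X]).coeff a).coeff b =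
        if i = a ∧ j = b then r ^ u * s else 0 := by
    intro u v i j r s
    have : (C (C r) ^ u * (X ^ i * C X ^ j) * C (C s) : A[X][X]) =
        C (C (r ^ u * s) * X ^ j) * X ^ i := by
      simp only [map_mul, map_pow]; ring
    rw [this, coeff_C_mul_X_pow]
    split_ifs with h1 h2 h2
    · rw [coeff_C_mul_X_pow, if_pos h2.2.symm]
    · rw [coeff_C_mul_X_pow, if_neg fun h => h2 ⟨h1.symm, h.symm⟩]
    · exact (h1 h2.1.symm).elim
    · simp
  have hco' : ∀ (u v i j : ℕ) (r s : A),
      ((C (C r) ^ u * (C X ^ i * X ^ j) * C (C s) : A[X][X]).coeff a).coeff b =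
        if i = b ∧ j = a then r ^ u * s else 0 := by
    intro u v i j r s
    rw [mul_comm (C X ^ i : A[X][X]), hco u v]
    exact if_congr and_comm rfl rfl
  have hsum : ∀ c d : ℕ, ∑ K : Finset (Fin n) with P.IsChainSet K ∧ #K = c,
      ∑ L : Finset (Fin n) with P.IsChainSet L ∧ #L = d,
        q ^ P.crossCard K L * G (K.val + L.val) =
      ∑ p : Finset (Fin n) × Finset (Fin n), (if P.IsChainSet p.1 ∧ P.IsChainSet p.2 then
        if #p.1 = c ∧ #p.2 = d then q ^ P.crossCard p.1 p.2 * G (p.1.val + p.2.val) else 0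
          else 0) := by
    intro c d
    rw [Fintype.sum_prod_type, sum_filter]
    refine sum_congr rfl fun K _ => ?_
    by_cases hK : P.IsChainSet K ∧ #K = c
    · rw [if_pos hK, sum_filter]
      refine sum_congr rfl fun L _ => ?_
      rw [← ite_and]
      exact if_congr (by tauto) rfl rfl
    · rw [if_neg hK]
      refine (sum_eq_zero fun L _ => ?_).symm
      rw [← ite_and]
      exact if_neg (by tauto)
  rw [hsum, hsum]
  simp only [finsetSum_coeff, apply_ite (fun f : A[X][X] => (f.coeff a).coeff b), hco _ 0,
    hco' _ 0, coeff_zero] at key2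
  exact key2

end Commutation

end NatUnitIntervalOrder

/-! ### Decreasing and descent-free words, inversions, and the weight of a word. -/

/-- Summing over all splittings of a nonempty word into an `r`-chain followed by a `¬r`-chain with
alternating signs gives zero. -/
theorem List.sum_neg_one_pow_isChain_take_drop {α : Type*} (r : α → α → Prop)
    [∀ a b, Decidable (r a b)] (z : List α) (hz : z ≠ []) :
    ∑ i ∈ Finset.range (z.length + 1),
      (if (z.take i).IsChain r ∧ (z.drop i).IsChain (fun a b => ¬ r a b) then (-1 : ℤ) ^ i else 0)
        = 0 := by
  induction z with
  | nil => exact (hz rfl).elim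
  | cons a z ih =>
    rw [Finset.sum_range_succ']
    rcases z with _ | ⟨b, z⟩
    · simp
    -- If `r a b`, the empty prefix is excluded and the other terms are the negatives of those for
    -- the tail. If not, prefixes of length at least two are excluded, and lengths zero and one
    -- cancel.
    · by_cases hab : r a b
      · have h1 : ∀ i, ((a :: b :: z).take (i + 1)).IsChain r ↔ ((b :: z).take i).IsChain r := by
          intro i
          rcases i with _ | i <;> simp [hab]
        simp only [h1, List.length_cons, List.drop_succ_cons]
        have h2 := ih (List.cons_ne_nil _ _)
        rw [List.length_cons] at h2
        rw [if_neg (by simp [hab]), add_zero, ← neg_eq_zero]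
        refine Eq.trans ?_ h2
        rw [← Finset.sum_neg_distrib]
        refine Finset.sum_congr rfl fun i _ => ?_
        split_ifs
        · rw [pow_succ]; ring
        · simp
      · rw [List.length_cons, Finset.sum_range_succ', Finset.sum_eq_zero fun i _ => ?_]
        · simp only [List.take_zero, List.drop_zero, List.isChain_cons_cons, hab]
          by_cases h : (b :: z).IsChain (fun a b => ¬ r a b) <;> simp [h]
        · exact if_neg (by simp [hab])

/-- The words of length `k`. -/
noncomputable def wordsOfLength (n k : ℕ) : Finset (List (Fin n)) :=
  (List.finite_length_eq (Fin n) k).toFinset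

theorem mem_wordsOfLength {n k : ℕ} {w : List (Fin n)} : w ∈ wordsOfLength n k ↔ w.length = k := by
  simp [wordsOfLength]

theorem sum_wordsOfLength_append {n : ℕ} {M : Type*} [AddCommMonoid M] (i j : ℕ)
    (F : List (Fin n) → List (Fin n) → M) :
    ∑ w ∈ wordsOfLength n i, ∑ w' ∈ wordsOfLength n j, F w w' =
      ∑ z ∈ wordsOfLength n (i + j), F (z.take i) (z.drop i) := by
  rw [← Finset.sum_product']
  refine Finset.sum_bij' (fun p _ => p.1 ++ p.2) (fun z _ => (z.take i, z.drop i)) ?_ ?_ ?_ ?_ ?_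
  · intro p hp
    simp only [Finset.mem_product, mem_wordsOfLength] at hp
    simp [mem_wordsOfLength, hp]
  · intro z hz
    simp only [mem_wordsOfLength] at hz
    simp [mem_wordsOfLength, hz]
  · intro p hp
    simp only [Finset.mem_product, mem_wordsOfLength] at hp
    simp [← hp.1]
  · intro z _
    simp
  · intro p hp
    simp only [Finset.mem_product, mem_wordsOfLength] at hp
    simp [← hp.1]

namespace NatUnitIntervalOrder

open Finset

section Words

open scoped Classical

variable {n : ℕ} (P : NatUnitIntervalOrder n)

/-- The words of length `k` that are strictly decreasing in `P`. -/
noncomputable def decWords (k : ℕ) : Finset (List (Fin n)) :=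
  {w ∈ wordsOfLength n k | w.IsChain fun a b => P.lt b a}

/-- The words of length `k` without `P`-descents. -/
noncomputable def ascWords (k : ℕ) : Finset (List (Fin n)) :=
  {w ∈ wordsOfLength n k | w.IsChain fun a b => ¬ P.lt b a}

variable {P}

theorem mem_decWords {k : ℕ} {w : List (Fin n)} :
    w ∈ P.decWords k ↔ w.length = k ∧ w.IsChain fun a b => P.lt b a := by
  rw [decWords, mem_filter, mem_wordsOfLength]

theorem mem_ascWords {k : ℕ} {w : List (Fin n)} :
    w ∈ P.ascWords k ↔ w.length = k ∧ w.IsChain fun a b => ¬ P.lt b a := by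
  rw [ascWords, mem_filter, mem_wordsOfLength]

theorem decWords_zero : P.decWords 0 = {[]} := by
  ext w
  rw [mem_decWords, List.length_eq_zero_iff, mem_singleton]
  exact ⟨fun h => h.1, by rintro rfl; simp⟩

theorem ascWords_zero : P.ascWords 0 = {[]} := by
  ext w
  rw [mem_ascWords, List.length_eq_zero_iff, mem_singleton]
  exact ⟨fun h => h.1, by rintro rfl; simp⟩

theorem lt_of_plt {a b : Fin n} (h : P.lt a b) : a < b := (P.le_m a).trans_lt h

/-- Grouped by the concatenated word `z`, the coefficient of `F z` is the signed count of cuts of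
`z` into a decreasing prefix and a descent-free suffix. -/
theorem sum_decWords_mul_ascWords {M : Type*} [AddCommGroup M] {k : ℕ} (hk : k ≠ 0)
    (F : List (Fin n) → M) :
    ∑ p ∈ antidiagonal k, (-1 : ℤ) ^ p.1 •
      ∑ w ∈ P.decWords p.1, ∑ w' ∈ P.ascWords p.2, F (w ++ w') = 0 := by
  have h1 : ∀ p ∈ antidiagonal k, (-1 : ℤ) ^ p.1 •
      ∑ w ∈ P.decWords p.1, ∑ w' ∈ P.ascWords p.2, F (w ++ w') =
      ∑ z ∈ wordsOfLength n k, (if (z.take p.1).IsChain (fun a b => P.lt b a) ∧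
        (z.drop p.1).IsChain (fun a b => ¬ P.lt b a) then (-1 : ℤ) ^ p.1 else 0) • F z := by
    intro p hp
    rw [← HasAntidiagonal.mem_antidiagonal.1 hp]
    simp only [decWords, ascWords, sum_filter]
    rw [show ∑ w ∈ wordsOfLength n p.1, (if w.IsChain (fun a b => P.lt b a) then
        ∑ w' ∈ wordsOfLength n p.2,
          if w'.IsChain (fun a b => ¬ P.lt b a) then F (w ++ w') else 0 else 0) =
      ∑ w ∈ wordsOfLength n p.1, ∑ w' ∈ wordsOfLength n p.2,
        if w.IsChain (fun a b => P.lt b a) ∧ w'.IsChain (fun a b => ¬ P.lt b a) then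
          F (w ++ w') else 0 from sum_congr rfl fun w _ => by
        split_ifs with h <;> simp [h]]
    rw [sum_wordsOfLength_append, smul_sum]
    refine sum_congr rfl fun z _ => ?_
    rw [List.take_append_drop]
    split_ifs <;> simp
  rw [sum_congr rfl h1, sum_comm]
  refine sum_eq_zero fun z hz => ?_
  rw [mem_wordsOfLength] at hz
  rw [← sum_smul, Nat.sum_antidiagonal_eq_sum_range_succ_mk, ← hz,
    List.sum_neg_one_pow_isChain_take_drop (fun a b => P.lt b a) z (by
      rintro rfl; exact hk hz.symm), zero_smul]

variable (P) in
/-- The number of `P`-inversion pairs between a word with content `u` and a following word with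
content `v`. -/
noncomputable def cross (u v : Multiset (Fin n)) : ℕ :=
  (u.map fun x => v.countP fun y => y < x ∧ ¬ P.lt y x).sum

theorem cross_add_left (u u' v : Multiset (Fin n)) :
    P.cross (u + u') v = P.cross u v + P.cross u' v := by
  simp [cross]

theorem cross_add_right (u v v' : Multiset (Fin n)) :
    P.cross u (v + v') = P.cross u v + P.cross u v' := by
  simp [cross]

theorem crossCard_eq_cross (K L : Finset (Fin n)) : P.crossCard K L = P.cross K.val L.val := by
  rw [crossCard, cross]
  refine sum_congr rfl fun x _ => ?_
  rw [← card_filter, Multiset.countP_eq_card_filter]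
  rfl

theorem inc_adj_and_lt_iff {x y : Fin n} : (P.inc.Adj x y ∧ y < x) ↔ y < x ∧ ¬ P.lt y x := by
  constructor
  · exact fun h => ⟨h.2, h.1.2.2⟩
  · exact fun h => ⟨⟨h.1.ne', fun hxy => lt_asymm h.1 (lt_of_plt hxy), h.2⟩, h.1⟩

theorem inv_nil : P.inv [] = 0 := by simp [inv]

theorem inv_cons (a : Fin n) (w : List (Fin n)) :
    P.inv (a :: w) = P.cross {a} w + P.inv w := by
  have hc : P.cross {a} w = ∑ j : Fin w.length, if w.get j < a ∧ ¬ P.lt (w.get j) a then 1 else 0 := by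
    rw [cross, Multiset.map_singleton, Multiset.sum_singleton, Multiset.coe_countP]
    induction w with
    | nil => simp
    | cons b w ih =>
      rw [List.countP_cons, ih, add_comm]
      simp only [List.length_cons]
      rw [Fin.sum_univ_succ]
      simp only [decide_eq_true_eq, List.get_cons_zero, List.get_cons_succ']
      congr!
  have hi : ∀ w : List (Fin n), P.inv w = ∑ i : Fin w.length, ∑ j : Fin w.length,
      if i < j ∧ w.get j < w.get i ∧ ¬ P.lt (w.get j) (w.get i) then 1 else 0 := by
    intro w
    rw [inv, card_filter, Fintype.sum_prod_type]
    simp only [inc_adj_and_lt_iff]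
  rw [hi, hi, hc]
  simp only [List.length_cons]
  rw [Fin.sum_univ_succ, Fin.sum_univ_succ]
  congr 1
  · simp [Fin.succ_pos]
  · refine sum_congr rfl fun i _ => ?_
    rw [Fin.sum_univ_succ]
    simp

theorem inv_append (u v : List (Fin n)) : P.inv (u ++ v) = P.inv u + P.inv v + P.cross u v := by
  induction u with
  | nil => simp [inv_nil, cross]
  | cons a u ih =>
    rw [List.cons_append, inv_cons, inv_cons, ih, ← Multiset.coe_add, cross_add_right,
      ← Multiset.cons_coe, ← Multiset.singleton_add, cross_add_left]
    ring

theorem pairwise_of_isChain {w : List (Fin n)} (h : w.IsChain fun a b => P.lt b a) :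
    w.Pairwise fun a b => P.lt b a := by
  have : IsTrans (Fin n) fun a b => P.lt b a := ⟨fun a b c h1 h2 => P.isStrictOrder.trans _ _ _ h2 h1⟩
  exact h.pairwise

theorem inv_eq_zero {w : List (Fin n)} (h : w.IsChain fun a b => P.lt b a) : P.inv w = 0 := by
  have h := pairwise_of_isChain h
  induction w with
  | nil => exact inv_nil
  | cons a w ih =>
    rw [List.pairwise_cons] at h
    rw [inv_cons, ih h.2.isChain h.2, add_zero, cross, Multiset.map_singleton,
      Multiset.sum_singleton, Multiset.countP_eq_zero]
    exact fun b hb hba => hba.2 (h.1 b hb)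

theorem isChain_sort {K : Finset (Fin n)} (hK : P.IsChainSet K) :
    (K.sort (· ≥ ·)).IsChain fun a b => P.lt b a := by
  have h1 : (K.sort (· ≥ ·)).Pairwise (· > ·) := K.sortedGT_sort.pairwise
  refine List.Pairwise.isChain ?_
  refine h1.imp_of_mem fun {a b} ha hb hab => ?_
  exact hK b ((mem_sort _).1 hb) a ((mem_sort _).1 ha) hab

theorem toFinset_sort_ge {w : List (Fin n)} (h : w.IsChain fun a b => P.lt b a) :
    w.toFinset.sort (· ≥ ·) = w := by
  have h2 : w.Pairwise (· > ·) := (pairwise_of_isChain h).imp fun hab => lt_of_plt hab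
  exact (List.toFinset_sort (· ≥ ·) (h2.imp fun hab => hab.ne')).2 (h2.imp fun hab => hab.le)

theorem isChainSet_toFinset {w : List (Fin n)} (h : w.IsChain fun a b => P.lt b a) :
    P.IsChainSet w.toFinset := by
  intro x hx y hy hxy
  rw [List.mem_toFinset] at hx hy
  by_contra hlt
  have hp := (pairwise_of_isChain h).imp (S := fun a b => b < a ∧ P.lt b a)
    fun hab => ⟨lt_of_plt hab, hab⟩
  clear h
  induction w with
  | nil => simp at hx
  | cons a w ih =>
    rw [List.pairwise_cons] at hp
    rcases List.mem_cons.1 hx with rfl | hx' <;> rcases List.mem_cons.1 hy with rfl | hy'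
    · exact lt_irrefl _ hxy
    · exact lt_asymm hxy (hp.1 y hy').1
    · exact hlt (hp.1 x hx').2
    · exact ih hx' hy' hp.2

/-- A strictly `P`-decreasing word has distinct letters forming a chain, and it is the decreasing
listing of that chain. -/
theorem sum_decWords {M : Type*} [AddCommMonoid M] (k : ℕ) (F : List (Fin n) → M) :
    ∑ w ∈ P.decWords k, F w =
      ∑ K : Finset (Fin n) with P.IsChainSet K ∧ #K = k, F (K.sort (· ≥ ·)) := by
  refine sum_bij' (fun w _ => w.toFinset) (fun K _ => K.sort (· ≥ ·)) ?_ ?_ ?_ ?_ ?_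
  · intro w hw
    rw [mem_decWords] at hw
    rw [mem_filter]
    refine ⟨mem_univ _, isChainSet_toFinset hw.2, ?_⟩
    rw [← hw.1, ← length_sort (· ≥ ·), toFinset_sort_ge hw.2]
  · intro K hK
    rw [mem_filter] at hK
    exact mem_decWords.2 ⟨by rw [length_sort, hK.2.2], isChain_sort hK.2.1⟩
  · intro w hw
    exact toFinset_sort_ge (mem_decWords.1 hw).2
  · intro K _
    exact Finset.sort_toFinset K (· ≥ ·)
  · intro w hw
    rw [toFinset_sort_ge (mem_decWords.1 hw).2]

open Polynomial in
/-- The functional on words given by `q^inv` on words of type `μ` and zero on other words. -/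
noncomputable def wordWeight (P : NatUnitIntervalOrder n) (μ : Fin n → ℕ) (w : List (Fin n)) :
    ℚ[X] :=
  if ∀ i, w.count i = μ i then X ^ P.inv w else 0

open Polynomial in
-- The type condition and the inversions involving the fixed `u` and `v` see only the content of the
-- middle factor, not the order of its letters.
theorem exists_wordWeight_append (μ : Fin n → ℕ) (u v : List (Fin n)) :
    ∃ G : Multiset (Fin n) → ℚ[X], ∀ z : List (Fin n),
      P.wordWeight μ (u ++ z ++ v) = X ^ P.inv z * G z := by
  refine ⟨fun m => if ∀ i, u.count i + m.count i + v.count i = μ i then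
    X ^ (P.inv u + P.inv v + P.cross u v + P.cross u m + P.cross m v) else 0, fun z => ?_⟩
  simp only [wordWeight, List.count_append, Multiset.coe_count]
  split_ifs
  · rw [← pow_add, inv_append, inv_append, ← Multiset.coe_add, cross_add_left]
    congr 1
    ring
  · rw [mul_zero]

/-- Decreasing words have no inversions of their own, so the middle factor `w ++ w'` contributes
exactly the crossing pairs of two chains, and `sum_chains_comm` applies. -/
theorem sum_decWords_wordWeight_comm (μ : Fin n → ℕ) (u v : List (Fin n)) (a b : ℕ) :
    ∑ w ∈ P.decWords a, ∑ w' ∈ P.decWords b, P.wordWeight μ (u ++ (w ++ w') ++ v) =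
      ∑ w ∈ P.decWords b, ∑ w' ∈ P.decWords a, P.wordWeight μ (u ++ (w ++ w') ++ v) := by
  obtain ⟨G, hG⟩ := exists_wordWeight_append (P := P) μ u v
  have key : ∀ a b, ∑ w ∈ P.decWords a, ∑ w' ∈ P.decWords b, P.wordWeight μ (u ++ (w ++ w') ++ v) =
      ∑ K : Finset (Fin n) with P.IsChainSet K ∧ #K = a,
      ∑ L : Finset (Fin n) with P.IsChainSet L ∧ #L = b,
        Polynomial.X ^ P.crossCard K L * G (K.val + L.val) := by
    intro a b
    simp only [sum_decWords]
    refine sum_congr rfl fun K hK => sum_congr rfl fun L hL => ?_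
    rw [mem_filter] at hK hL
    rw [hG, inv_append, inv_eq_zero (isChain_sort hK.2.1), inv_eq_zero (isChain_sort hL.2.1),
      ← Multiset.coe_add, sort_eq, sort_eq, crossCard_eq_cross, zero_add, zero_add]
  rw [key, key, sum_chains_comm]

end Words

end NatUnitIntervalOrder

/-! ### Products of sets of words, and evaluation of the dual Cauchy identity at commuting elements.
-/

open Finset

/-- Prepending an element to a list, as an embedding. -/
def consEmbedding (α : Type*) : α × List α ↪ List α where
  toFun p := p.1 :: p.2
  inj' p p' h := by
    rw [List.cons.injEq] at h
    exact Prod.ext h.1 h.2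

theorem consEmbedding_apply {α : Type*} (p : α × List α) : consEmbedding α p = p.1 :: p.2 := rfl

/-- All lists whose `i`-th entry belongs to the `i`-th given set. -/
def listProd {α : Type*} : List (Finset α) → Finset (List α)
  | [] => {[]}
  | A :: As => (A ×ˢ listProd As).map (consEmbedding α)

theorem mem_listProd {α : Type*} {As : List (Finset α)} {s : List α} :
    s ∈ listProd As ↔ List.Forall₂ (· ∈ ·) s As := by
  induction As generalizing s with
  | nil => simp [listProd]
  | cons A As ih =>
    simp only [listProd, mem_map, mem_product, consEmbedding_apply, Prod.exists, ih]
    rcases s with _ | ⟨a, s⟩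
    · simp
    · rw [List.forall₂_cons]
      constructor
      · rintro ⟨a', s', h, h'⟩
        rw [List.cons.injEq] at h'
        exact h'.1 ▸ h'.2 ▸ h
      · exact fun h => ⟨a, s, h, rfl⟩

namespace SymFn

/-- If elements `a_k` of a commutative algebra satisfy the same relations with `b_k` as the `e_k`
with the `h_k`, then the homomorphism with `e_k ↦ a_k` sends `h_k` to `b_k`. -/
theorem exists_algHom_e_h {B : Type*} [CommRing B] [Algebra ℚ B] {a b : ℕ → B} (ha : a 0 = 1)
    (hb : b 0 = 1)
    (hab : ∀ k, k ≠ 0 → ∑ p ∈ antidiagonal k, (-1 : B) ^ p.1 * (a p.1 * b p.2) = 0) :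
    ∃ F : Sym ℚ →ₐ[ℚ] B, (∀ k, F (e ℚ k) = a k) ∧ ∀ k, F (h ℚ k) = b k := by
  let F : Sym ℚ →ₐ[ℚ] B :=
    (MvPolynomial.aeval fun k => a (k + 1)).comp (eEquiv ℚ).symm.toAlgHom
  have hFe : ∀ k, F (e ℚ k) = a k := by
    intro k
    rcases k with _ | k
    · rw [e_zero, map_one, ha]
    · have : (eEquiv ℚ).symm (e ℚ (k + 1)) = MvPolynomial.X k := by
        rw [AlgEquiv.symm_apply_eq]
        simp [eEquiv, eHom]
      simp [F, this]
  refine ⟨F, hFe, fun k => ?_⟩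
  refine eq_of_sum_antidiagonal_eq_zero (a := a) (b := fun k => F (h ℚ k)) ha
    (by rw [h_zero, map_one, hb]) (fun k hk => ?_) hab k
  have := congrArg F (sum_antidiagonal_e_mul_h ℚ hk)
  simpa only [map_sum, map_mul, map_pow, map_neg, map_one, hFe, map_zero] using this

/-- The dual Cauchy identity, evaluated at commuting elements of an algebra that satisfy the
relations between the elementary and the complete homogeneous symmetric functions. -/
theorem sum_coeff_forgotten_smul_prod {E : Type*} [Ring E] [Algebra ℚ E] {a b : ℕ → E}
    (ha : a 0 = 1) (hb : b 0 = 1) (hcomm : ∀ i j, b i * b j = b j * b i)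
    (hba : ∀ k, k ≠ 0 → ∑ p ∈ antidiagonal k, (-1 : E) ^ p.1 * (b p.1 * a p.2) = 0)
    (k : ℕ) (d : ℕ →₀ ℕ) (cs : List ℕ) (hcs : cs.Nodup) (hd : d.support ⊆ cs.toFinset) :
    ∑ ν : k.Partition, MvPowerSeries.coeff d (forgotten ℚ ν : MvPowerSeries ℕ ℚ) •
        ((ν.parts.sort (· ≥ ·)).map a).prod =
      if d.degree = k then (cs.map fun c => b (d c)).prod else 0 := by
  -- The ambient algebra need not be commutative, but the subalgebra generated by the commuting `b
  -- k` is. The recursion in `hba` places the `a k` in it as well, so symmetric functions can be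
  -- evaluated there.
  let U : Subalgebra ℚ E := Algebra.adjoin ℚ (Set.range b)
  have hU : IsMulCommutative U := Algebra.isMulCommutative_adjoin ℚ (by
    rintro _ ⟨i, rfl⟩ _ ⟨j, rfl⟩
    exact hcomm i j)
  let _ : CommRing U := { U.toRing with mul_comm := hU.is_comm.comm }
  have hbU : ∀ k, b k ∈ U := fun k => Algebra.subset_adjoin ⟨k, rfl⟩
  have haU : ∀ k, a k ∈ U := by
    intro k
    induction k using Nat.strong_induction_on with
    | _ k ih =>
      rcases k with _ | k
      · rw [ha]; exact one_mem _
      · have h := hba (k + 1) k.succ_ne_zero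
        rw [Nat.antidiagonal_succ, sum_cons] at h
        simp only [pow_zero, hb, one_mul] at h
        rw [eq_neg_of_add_eq_zero_left h]
        refine neg_mem (sum_mem fun p hp => ?_)
        obtain ⟨p', hp', rfl⟩ := mem_map.1 hp
        have := HasAntidiagonal.mem_antidiagonal.1 hp'
        exact mul_mem (pow_mem (neg_mem (one_mem _)) _) (mul_mem (hbU _) (ih p'.2 (by omega)))
  obtain ⟨F, hFe, hFh⟩ := exists_algHom_e_h (B := U) (a := fun k => ⟨a k, haU k⟩)
    (b := fun k => ⟨b k, hbU k⟩) (Subtype.ext ha) (Subtype.ext hb) fun k hk =>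
      neg_one_pow_mul_antidiagonal_swap (B := U) (a := fun k => ⟨b k, hbU k⟩)
        (b := fun k => ⟨a k, haU k⟩) (Subtype.ext (by
          refine Eq.trans ?_ (hba k hk)
          rw [AddSubmonoidClass.coe_finsetSum]
          rfl))
  have he : ∀ ν : k.Partition, (F (eProd ℚ (expo ν)) : E) =
      ((ν.parts.sort (· ≥ ·)).map a).prod := by
    intro ν
    have h : F (eProd ℚ (expo ν)) =
        ((ν.parts.sort (· ≥ ·)).map fun k => (⟨a k, haU k⟩ : U)).prod := by
      rw [← Multiset.prod_coe, ← Multiset.map_coe, Multiset.sort_eq, ← map_expo ν,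
        Multiset.map_map, eProd, map_prod]
      simp only [hFe]
      rfl
    rw [h, ← Subalgebra.coe_val, map_list_prod, List.map_map]
    rfl
  have hh : (F (hProd ℚ d) : E) = (cs.map fun c => b (d c)).prod := by
    have h : F (hProd ℚ d) = (cs.map fun c => (⟨b (d c), hbU _⟩ : U)).prod := by
      rw [← List.prod_toFinset _ hcs, hProd, map_prod]
      simp only [hFh]
      -- Entries of `cs` outside the support of `d` contribute `b 0 = 1`.
      refine prod_subset hd fun c _ hc => Subtype.ext ?_
      rw [Finsupp.notMem_support_iff.1 hc]
      exact hb
    rw [h, ← Subalgebra.coe_val, map_list_prod, List.map_map]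
    rfl
  have key := congrArg (fun x : U => (x : E))
    (congrArg F (sum_coeff_forgotten_smul_eProd (R := ℚ) k d))
  simp only [map_sum, map_smul, AddSubmonoidClass.coe_finsetSum, Subalgebra.coe_smul, he] at key
  rw [key]
  split_ifs
  · exact hh
  · rw [map_zero]; rfl

theorem sum_coeff_forgotten_smul_prod_apply {V : Type*} [AddCommGroup V] [Module ℚ V]
    {a b : ℕ → Module.End ℚ V} (ha : a 0 = 1) (hb : b 0 = 1)
    (hcomm : ∀ i j, b i * b j = b j * b i)
    (hba : ∀ k, k ≠ 0 → ∀ x, ∑ p ∈ antidiagonal k, (-1 : ℤ) ^ p.1 • b p.1 (a p.2 x) = 0)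
    (k : ℕ) (d : ℕ →₀ ℕ) (cs : List ℕ) (hcs : cs.Nodup) (hd : d.support ⊆ cs.toFinset) (x : V) :
    ∑ ν : k.Partition, MvPowerSeries.coeff d (forgotten ℚ ν : MvPowerSeries ℕ ℚ) •
        ((ν.parts.sort (· ≥ ·)).map a).prod x =
      if d.degree = k then (cs.map fun c => b (d c)).prod x else 0 := by
  have hrel : ∀ k, k ≠ 0 →
      ∑ p ∈ antidiagonal k, (-1 : Module.End ℚ V) ^ p.1 * (b p.1 * a p.2) = 0 := by
    intro k hk
    refine LinearMap.ext fun x => ?_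
    rw [LinearMap.sum_apply, LinearMap.zero_apply, ← hba k hk x]
    refine sum_congr rfl fun p _ => ?_
    rcases Nat.even_or_odd p.1 with hp | hp <;> simp [hp.neg_one_pow]
  have h := congrArg (fun T : Module.End ℚ V => T x)
    (sum_coeff_forgotten_smul_prod ha hb hcomm hrel k d cs hcs hd)
  simp only [LinearMap.sum_apply, LinearMap.smul_apply] at h
  rw [h]
  split_ifs <;> rfl

end SymFn

/-! ### Words acting as operators on functions of words. -/

section Operators

variable {n : ℕ} {M : Type*} [AddCommGroup M] [Module ℚ M]

/-- The operator on functions of words that sums over all ways of appending a word from `L`. -/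
noncomputable def appendOp (L : Finset (List (Fin n))) : Module.End ℚ (List (Fin n) → M) where
  toFun f v := ∑ w ∈ L, f (v ++ w)
  map_add' f g := by ext1 v; simp [sum_add_distrib]
  map_smul' r f := by ext1 v; simp [smul_sum]

theorem appendOp_apply (L : Finset (List (Fin n))) (f : List (Fin n) → M) (v : List (Fin n)) :
    appendOp L f v = ∑ w ∈ L, f (v ++ w) := rfl

/-- The outermost operator appends its word first, so composition in list order is concatenation
from left to right. -/
theorem prod_map_appendOp_apply (Ls : List (Finset (List (Fin n)))) (f : List (Fin n) → M)
    (v : List (Fin n)) :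
    (Ls.map appendOp).prod f v = ∑ s ∈ listProd Ls, f (v ++ s.flatten) := by
  induction Ls generalizing v with
  | nil => simp [listProd]
  | cons A As ih =>
    rw [List.map_cons, List.prod_cons, Module.End.mul_apply, appendOp_apply]
    simp only [ih, listProd, sum_map, sum_product, consEmbedding_apply, List.flatten_cons,
      List.append_assoc]

namespace NatUnitIntervalOrder

variable (P : NatUnitIntervalOrder n)

/-- The functions of words for which the sets of strictly decreasing words commute. -/
noncomputable def commSubmodule (M : Type*) [AddCommGroup M] [Module ℚ M] : Submodule ℚ (List (Fin n) → M) where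
  carrier := {f | ∀ a b u v, ∑ w ∈ P.decWords a, ∑ w' ∈ P.decWords b, f (u ++ (w ++ w') ++ v) =
    ∑ w ∈ P.decWords b, ∑ w' ∈ P.decWords a, f (u ++ (w ++ w') ++ v)}
  add_mem' {f g} hf hg a b u v := by
    simp only [Pi.add_apply, sum_add_distrib, hf a b u v, hg a b u v]
  zero_mem' a b u v := by simp
  smul_mem' r f hf a b u v := by
    simp only [Pi.smul_apply, ← smul_sum, hf a b u v]

/-- The appended word is absorbed into the right context `v` in the definition of `commSubmodule`;
this is why commutation is required in every context and not only for bare products. -/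
theorem appendOp_mem_commSubmodule (L : Finset (List (Fin n))) (f : List (Fin n) → M)
    (hf : f ∈ P.commSubmodule M) : appendOp L f ∈ P.commSubmodule M := by
  intro a b u v
  simp only [appendOp_apply]
  have h : ∀ a b, ∑ w ∈ P.decWords a, ∑ w' ∈ P.decWords b, ∑ l ∈ L, f (u ++ (w ++ w') ++ v ++ l) =
      ∑ l ∈ L, ∑ w ∈ P.decWords a, ∑ w' ∈ P.decWords b, f (u ++ (w ++ w') ++ (v ++ l)) := by
    intro a b
    simp only [List.append_assoc]
    rw [sum_comm]
    refine Eq.trans ?_ sum_comm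
    refine Eq.trans sum_comm (sum_congr rfl fun w _ => ?_)
    exact sum_comm
  rw [h, h]
  exact sum_congr rfl fun l _ => hf a b u (v ++ l)

/-- The restriction of `appendOp L` to `commSubmodule`. -/
noncomputable def wordOp (L : Finset (List (Fin n))) : Module.End ℚ (P.commSubmodule M) :=
  (appendOp L).restrict (P.appendOp_mem_commSubmodule L)

theorem coe_wordOp_apply (L : Finset (List (Fin n))) (f : P.commSubmodule M) :
    (P.wordOp L f : List (Fin n) → M) = appendOp L f := rfl

theorem coe_prod_map_wordOp_apply (Ls : List (Finset (List (Fin n)))) (f : P.commSubmodule M) :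
    ((Ls.map P.wordOp).prod f : List (Fin n) → M) = (Ls.map appendOp).prod f := by
  induction Ls with
  | nil => rfl
  | cons A As ih =>
    rw [List.map_cons, List.prod_cons, Module.End.mul_apply, coe_wordOp_apply, ih]
    rfl

theorem wordOp_singleton_nil : P.wordOp (M := M) {[]} = 1 := by
  refine LinearMap.ext fun f => Subtype.ext (funext fun v => ?_)
  rw [coe_wordOp_apply, appendOp_apply]
  simp

theorem wordOp_decWords_comm (a b : ℕ) :
    P.wordOp (M := M) (P.decWords a) * P.wordOp (P.decWords b) =
    P.wordOp (P.decWords b) * P.wordOp (P.decWords a) := by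
  refine LinearMap.ext fun f => Subtype.ext (funext fun v => ?_)
  simpa [Module.End.mul_apply, coe_wordOp_apply, appendOp_apply] using f.2 a b v []

theorem sum_wordOp_decWords_mul_ascWords {k : ℕ} (hk : k ≠ 0) (f : P.commSubmodule M) :
    ∑ p ∈ antidiagonal k, (-1 : ℤ) ^ p.1 •
      P.wordOp (P.decWords p.1) (P.wordOp (P.ascWords p.2) f) = 0 := by
  refine Subtype.ext (funext fun v => ?_)
  rw [AddSubmonoidClass.coe_finsetSum, Finset.sum_apply]
  simpa [coe_wordOp_apply, appendOp_apply] using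
    sum_decWords_mul_ascWords (P := P) hk fun w => (f : List (Fin n) → M) (v ++ w)

/-- On `commSubmodule` the operators of decreasing words commute and play the role of the `h_k`,
those of descent-free words the role of the `e_k`. The dual Cauchy identity for them is applied to
`f` and evaluated at the empty word. -/
theorem sum_coeff_forgotten_smul_sum_listProd {f : List (Fin n) → M} (hf : f ∈ P.commSubmodule M)
    (k : ℕ) (d : ℕ →₀ ℕ) (cs : List ℕ) (hcs : cs.Nodup) (hd : d.support ⊆ cs.toFinset) :
    ∑ ν : k.Partition,
      MvPowerSeries.coeff d (SymFn.forgotten ℚ ν : MvPowerSeries ℕ ℚ) •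
        ∑ s ∈ listProd ((ν.parts.sort (· ≥ ·)).map P.ascWords), f s.flatten =
      if d.degree = k then
        ∑ s ∈ listProd (cs.map fun c => P.decWords (d c)), f s.flatten else 0 := by
  have key := congrArg (fun g : P.commSubmodule M => (g : List (Fin n) → M) [])
    (SymFn.sum_coeff_forgotten_smul_prod_apply
      (a := fun k => P.wordOp (M := M) (P.ascWords k)) (b := fun k => P.wordOp (P.decWords k))
      (by rw [ascWords_zero, wordOp_singleton_nil]) (by rw [decWords_zero, wordOp_singleton_nil])
      P.wordOp_decWords_comm (fun k hk => P.sum_wordOp_decWords_mul_ascWords hk) k d cs hcs hd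
      ⟨f, hf⟩)
  have hL : ∀ Ls : List (Finset (List (Fin n))),
      ((Ls.map P.wordOp).prod ⟨f, hf⟩ : List (Fin n) → M) [] =
        ∑ s ∈ listProd Ls, f s.flatten := by
    intro Ls
    rw [coe_prod_map_wordOp_apply, prod_map_appendOp_apply]
    rfl
  have hmap : ∀ (l : List ℕ) (g : ℕ → Finset (List (Fin n))),
      (l.map fun k => P.wordOp (M := M) (g k)) = (l.map g).map P.wordOp := fun l g => by
    rw [List.map_map]; rfl
  simp only [hmap] at key
  simp only [AddSubmonoidClass.coe_finsetSum, Submodule.coe_smul, Finset.sum_apply, Pi.smul_apply,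
    hL] at key
  rw [key]
  split_ifs
  · exact hL _
  · rfl

open Polynomial in
theorem wordWeight_mem_commSubmodule (μ : Fin n → ℕ) : P.wordWeight μ ∈ P.commSubmodule ℚ[X] :=
  fun a b u v => sum_decWords_wordWeight_comm μ u v a b

end NatUnitIntervalOrder

end Operators

/-! ### Segmented words and multi-colorings as sequences of words. -/

open Finset

/-- Without repetitions in `cs`, each index carries one entry of `s`. The value `a₀` only fills in
outside `cs`. -/
theorem List.exists_eq_map_of_forall₂_map {α β γ : Type*} {r : α → β → Prop} {g : γ → β}
    [DecidableEq γ] {cs : List γ} (hcs : cs.Nodup) {s : List α} (hs : List.Forall₂ r s (cs.map g))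
    (a₀ : α) : ∃ W : γ → α, s = cs.map W ∧ ∀ c ∈ cs, r (W c) (g c) := by
  induction cs generalizing s with
  | nil => exact ⟨fun _ => a₀, by simpa using hs, by simp⟩
  | cons c cs ih =>
    rw [List.map_cons] at hs
    rcases s with _ | ⟨a, s⟩
    · simp at hs
    rw [List.forall₂_cons] at hs
    rw [List.nodup_cons] at hcs
    obtain ⟨W, rfl, hW⟩ := ih hcs.2 hs.2
    have hne : ∀ c' ∈ cs, Function.update W c a c' = W c' := fun c' hc' =>
      Function.update_of_ne (by rintro rfl; exact hcs.1 hc') _ _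
    refine ⟨Function.update W c a, ?_, ?_⟩
    · rw [List.map_cons, Function.update_self, List.map_congr_left hne]
    · intro c' hc'
      rcases List.mem_cons.1 hc' with rfl | hc'
      · rw [Function.update_self]; exact hs.1
      · rw [hne c' hc']; exact hW c' hc'

theorem length_of_mem_wordsOfType {n : ℕ} {μ : Fin n → ℕ} {w : List (Fin n)}
    (hw : w ∈ wordsOfType μ) : w.length = ∑ i, μ i := by
  rw [wordsOfType, mem_filter, mem_image] at hw
  obtain ⟨⟨f, _, rfl⟩, _⟩ := hw
  simp

namespace NatUnitIntervalOrder

open Polynomial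

variable {n : ℕ} (P : NatUnitIntervalOrder n)

theorem desSet_eq_empty_iff (w : List (Fin n)) :
    P.desSet w = ∅ ↔ w.IsChain fun a b => ¬ P.lt b a := by
  rw [List.isChain_iff_getElem, Set.eq_empty_iff_forall_notMem]
  exact ⟨fun h i hi hlt => h i ⟨hi, hlt⟩, fun h i ⟨hi, hlt⟩ => h i hi hlt⟩

theorem mem_listProd_map_ascWords {L : List ℕ} {s : List (List (Fin n))} :
    s ∈ listProd (L.map P.ascWords) ↔ s.map List.length = L ∧ ∀ v ∈ s, P.desSet v = ∅ := by
  rw [mem_listProd]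
  induction s generalizing L with
  | nil => simp [eq_comm]
  | cons v s ih =>
    rcases L with _ | ⟨l, L⟩
    · simp
    · rw [List.map_cons, List.forall₂_cons, ih, mem_ascWords, ← desSet_eq_empty_iff, List.map_cons,
        List.cons.injEq, List.forall_mem_cons]
      tauto

open Classical in
/-- The coefficient of the forgotten symmetric functions for a composition `L`. -/
theorem sum_segmentsDescentFree (μ : Fin n → ℕ) (L : List ℕ) :
    ∑ w ∈ wordsOfType μ with P.SegmentsDescentFree L w, (X : ℚ[X]) ^ P.inv w =
      ∑ s ∈ listProd (L.map P.ascWords), P.wordWeight μ s.flatten := by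
  simp only [wordWeight]
  rw [← sum_filter]
  symm
  refine sum_bij (fun s _ => s.flatten) ?_ ?_ ?_ ?_
  · intro s hs
    rw [mem_filter, mem_listProd_map_ascWords] at hs
    rw [mem_filter, mem_wordsOfType]
    exact ⟨hs.2, s, rfl, hs.1⟩
  · intro s hs s' hs' h
    rw [mem_filter, mem_listProd_map_ascWords] at hs hs'
    -- The segment lengths are prescribed, so the word determines its splitting.
    exact List.eq_iff_flatten_eq.2 ⟨h, hs.1.1.trans hs'.1.1.symm⟩
  · intro w hw
    rw [mem_filter, mem_wordsOfType] at hw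
    obtain ⟨hw, s, rfl, hs⟩ := hw
    exact ⟨s, mem_filter.2 ⟨P.mem_listProd_map_ascWords.2 hs, hw⟩, rfl⟩
  · intro s _
    rfl

/-- The vertices with colour `c`. -/
def colorClass (κ : Fin n → Finset ℕ) (c : ℕ) : Finset (Fin n) := {i | c ∈ κ i}

theorem mem_colorClass {κ : Fin n → Finset ℕ} {c : ℕ} {i : Fin n} :
    i ∈ colorClass κ c ↔ c ∈ κ i := by simp [colorClass]

/-- The words of the colour classes, in decreasing order of the colours `c < N`. -/
def colorWords (N : ℕ) (κ : Fin n → Finset ℕ) : List (List (Fin n)) :=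
  (List.range N).reverse.map fun c => (colorClass κ c).sort (· ≥ ·)

theorem colorContent_apply (κ : Fin n → Finset ℕ) (c : ℕ) :
    colorContent κ c = #(colorClass κ c) := by
  simp only [colorContent, Finsupp.finsetSum_apply, Finsupp.single_apply, sum_ite_eq', colorClass,
    card_filter]

theorem degree_colorContent (κ : Fin n → Finset ℕ) : (colorContent κ).degree = ∑ i, #(κ i) := by
  simp [colorContent]

theorem isChainSet_iff {K : Finset (Fin n)} :
    P.IsChainSet K ↔ ∀ i ∈ K, ∀ j ∈ K, ¬ P.inc.Adj i j := by
  constructor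
  · intro h i hi j hj hij
    rcases lt_or_gt_of_ne hij.1 with hlt | hlt
    · exact hij.2.1 (h i hi j hj hlt)
    · exact hij.2.2 (h j hj i hi hlt)
  · intro h i hi j hj hlt
    by_contra hn
    exact h i hi j hj ⟨hlt.ne, hn, fun h' => lt_asymm hlt (lt_of_plt h')⟩

theorem isProperMultiColoring_iff (μ : Fin n → ℕ) (κ : Fin n → Finset ℕ) :
    IsProperMultiColoring P.inc μ κ ↔
      (∀ i, #(κ i) = μ i) ∧ ∀ c, P.IsChainSet (colorClass κ c) := by
  rw [IsProperMultiColoring]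
  refine and_congr_right fun _ => ?_
  simp only [isChainSet_iff, mem_colorClass, disjoint_left]
  exact ⟨fun h c i hi j hj hij => h i j hij hi hj, fun h i j hij c hi hj => h c i hi j hj hij⟩

theorem count_flatten_colorWords {N : ℕ} {κ : Fin n → Finset ℕ} (hκ : ∀ i, κ i ⊆ range N)
    (i : Fin n) : (colorWords N κ).flatten.count i = #(κ i) := by
  have h1 : ∀ c, ((colorClass κ c).sort (· ≥ ·)).count i = if c ∈ κ i then 1 else 0 := by
    intro c
    rw [List.Nodup.count (sort_nodup _ _)]
    simp only [mem_sort, mem_colorClass]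
  rw [colorWords, List.count_flatten, List.map_map]
  simp only [Function.comp_def, h1]
  rw [List.map_reverse, List.sum_reverse, ← List.sum_toFinset _ List.nodup_range,
    List.toFinset_range, sum_boole, filter_mem_eq_inter, inter_eq_right.2 (hκ i), Nat.cast_id]

/-- Each class is a chain and has no inversions inside. Colours being read downwards, the class of
`s` precedes that of `r` for `r < s`. -/
theorem inv_flatten_colorWords {N : ℕ} {κ : Fin n → Finset ℕ}
    (hκ : ∀ c, P.IsChainSet (colorClass κ c)) : P.inv (colorWords N κ).flatten =
      ∑ s ∈ range N, ∑ r ∈ range s, P.crossCard (colorClass κ s) (colorClass κ r) := by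
  have hcross : ∀ (u : Multiset (Fin n)) (N : ℕ), P.cross u ((colorWords N κ).flatten) =
      ∑ r ∈ range N, P.cross u (colorClass κ r).val := by
    intro u N
    induction N with
    | zero => simp [colorWords, cross]
    | succ N ih =>
      have : colorWords (N + 1) κ = (colorClass κ N).sort (· ≥ ·) :: colorWords N κ := by
        simp [colorWords, List.range_succ]
      rw [this, List.flatten_cons, ← Multiset.coe_add, cross_add_right, ih, sum_range_succ,
        sort_eq, add_comm]
  induction N with
  | zero => simp [colorWords, inv_nil]
  | succ N ih =>
    have : colorWords (N + 1) κ = (colorClass κ N).sort (· ≥ ·) :: colorWords N κ := by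
      simp [colorWords, List.range_succ]
    rw [this, List.flatten_cons, inv_append, ih, inv_eq_zero (isChain_sort (hκ N)), sum_range_succ,
      hcross, zero_add, sort_eq]
    simp only [crossCard_eq_cross]

/-- An ascent `i < j`, `r < s` is a crossing pair with its larger vertex `j` in the class of the
larger colour `s`. -/
theorem asc_eq_sum {N : ℕ} {κ : Fin n → Finset ℕ} (hκ : ∀ i, κ i ⊆ range N) :
    asc P.inc κ =
      ∑ s ∈ range N, ∑ r ∈ range s, P.crossCard (colorClass κ s) (colorClass κ r) := by
  classical
  have hr : ∀ (i : Fin n) (F : ℕ → ℕ), ∑ r ∈ κ i, F r = ∑ r ∈ range N, if r ∈ κ i then F r else 0 := by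
    intro i F
    rw [← sum_filter, filter_mem_eq_inter, inter_eq_right.2 (hκ i)]
  have hs : ∀ s ∈ range N, ∀ F : ℕ → ℕ,
      ∑ r ∈ range s, F r = ∑ r ∈ range N, if r < s then F r else 0 := by
    intro s hs F
    rw [← sum_filter]
    refine sum_congr ?_ fun _ _ => rfl
    ext r
    simp only [mem_filter, mem_range] at hs ⊢
    omega
  have hc : ∀ (c : ℕ) (F : Fin n → ℕ), ∑ i ∈ colorClass κ c, F i =
      ∑ i, if c ∈ κ i then F i else 0 := fun c F => by
    rw [colorClass, sum_filter]
  have hadj : ∀ (i j : Fin n) (r s : ℕ), (P.inc.Adj i j ∧ i < j ∧ r < s) ↔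
      r < s ∧ i < j ∧ ¬ P.lt i j := fun i j r s => by
    rw [← and_assoc, P.inc.adj_comm, inc_adj_and_lt_iff, and_comm]
  have hpull : ∀ (p : Prop) [Decidable p] (s : Finset ℕ) (F : ℕ → ℕ),
      (if p then ∑ x ∈ s, F x else 0) = ∑ x ∈ s, if p then F x else 0 := fun p _ s F => by
    split_ifs <;> simp
  have hpull' : ∀ (p : Prop) [Decidable p] (F : Fin n → ℕ),
      (if p then ∑ x, F x else 0) = ∑ x, if p then F x else 0 := fun p _ F => by
    split_ifs <;> simp
  have hL : asc P.inc κ = ∑ i, ∑ r ∈ range N, ∑ j, ∑ s ∈ range N,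
      if r ∈ κ i ∧ s ∈ κ j ∧ r < s ∧ i < j ∧ ¬ P.lt i j then 1 else 0 := by
    rw [asc, card_filter, sum_product, sum_sigma]
    simp only [sum_sigma, hr, hadj, hpull, hpull', ← ite_and]
  have hR : ∑ s ∈ range N, ∑ r ∈ range s, P.crossCard (colorClass κ s) (colorClass κ r) =
      ∑ s ∈ range N, ∑ r ∈ range N, ∑ j, ∑ i,
        if r ∈ κ i ∧ s ∈ κ j ∧ r < s ∧ i < j ∧ ¬ P.lt i j then 1 else 0 := by
    refine sum_congr rfl fun s hs' => ?_
    rw [hs s hs']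
    simp only [crossCard, hc, hpull', ← ite_and]
    refine sum_congr rfl fun r _ => sum_congr rfl fun j _ => sum_congr rfl fun i _ =>
      if_congr ?_ rfl rfl
    tauto
  -- Both sides are now the same fourfold sum, up to the order of summation.
  rw [hL, hR, sum_comm]
  refine Eq.trans (sum_congr rfl fun r _ => sum_congr rfl fun i _ => sum_comm) ?_
  refine Eq.trans (sum_congr rfl fun r _ => sum_comm) ?_
  rw [sum_comm]
  exact sum_congr rfl fun s _ => sum_congr rfl fun r _ => sum_comm

open Classical in
-- A proper multi-coloring with content `d` is a sequence of chains of sizes `d c`. Listing them by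
-- decreasing colour makes inversions equal to ascents, and colours below `N` that are not used
-- contribute the empty word.
theorem coeff_chromaticQSym_inc (μ : Fin n → ℕ) (d : ℕ →₀ ℕ) {N : ℕ} (hN : d.support ⊆ range N) :
    MvPowerSeries.coeff d (chromaticQSym P.inc μ) =
      ∑ s ∈ listProd ((List.range N).reverse.map fun c => P.decWords (d c)),
        P.wordWeight μ s.flatten := by
  have hsupp : ∀ {κ : Fin n → Finset ℕ},
      κ ∈ Fintype.piFinset (fun _ : Fin n => d.support.powerset) → ∀ i, κ i ⊆ range N :=
    fun hκ i => (mem_powerset.1 (Fintype.mem_piFinset.1 hκ i)).trans hN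
  have hcs : (List.range N).reverse.Nodup := List.nodup_reverse.2 List.nodup_range
  simp only [wordWeight]
  rw [← sum_filter]
  change ∑ κ ∈ (Fintype.piFinset fun _ : Fin n => d.support.powerset) with
    IsProperMultiColoring P.inc μ κ ∧ colorContent κ = d, (X : ℚ[X]) ^ asc P.inc κ = _
  refine sum_bij (fun κ _ => colorWords N κ) ?_ ?_ ?_ ?_
  · intro κ hκ
    rw [mem_filter, isProperMultiColoring_iff] at hκ
    obtain ⟨h1, ⟨h2, h3⟩, h4⟩ := hκ
    rw [mem_filter, mem_listProd, colorWords, List.forall₂_map_left_iff, List.forall₂_map_right_iff,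
      List.forall₂_same]
    refine ⟨fun c _ => mem_decWords.2 ⟨?_, isChain_sort (h3 c)⟩, fun i => ?_⟩
    · rw [length_sort, ← h4, colorContent_apply]
    · exact (count_flatten_colorWords (hsupp h1) i).trans (h2 i)
  · intro κ hκ κ' hκ' h
    rw [mem_filter] at hκ hκ'
    rw [colorWords, colorWords, List.map_inj_left] at h
    ext i c
    by_cases hc : c ∈ range N
    · have h1 := h c (by simpa using hc)
      rw [← mem_colorClass, ← mem_colorClass, ← mem_sort (· ≥ ·), h1, mem_sort]
    · exact ⟨fun hi => (hc (hsupp hκ.1 i hi)).elim, fun hi => (hc (hsupp hκ'.1 i hi)).elim⟩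
  · intro s hs
    rw [mem_filter, mem_listProd] at hs
    obtain ⟨hs, hμ⟩ := hs
    obtain ⟨W, rfl, hW⟩ := List.exists_eq_map_of_forall₂_map hcs hs []
    replace hW : ∀ c ∈ range N, (W c).length = d c ∧ (W c).IsChain fun a b => P.lt b a :=
      fun c hc => mem_decWords.1 (hW c (by simpa using hc))
    -- The coloring is recovered by giving colour `c` to the letters of the word `W c`.
    let κ : Fin n → Finset ℕ := fun i => {c ∈ range N | i ∈ W c}
    have hκN : ∀ i, κ i ⊆ range N := fun i => filter_subset _ _
    have hcls : ∀ c ∈ range N, colorClass κ c = (W c).toFinset := by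
      intro c hc
      ext i
      rw [mem_colorClass, mem_filter, List.mem_toFinset]
      exact and_iff_right hc
    have hcls' : ∀ c, c ∉ range N → colorClass κ c = ∅ := by
      intro c hc
      ext i
      rw [mem_colorClass, mem_filter]
      simp [hc]
    have hwords : colorWords N κ = (List.range N).reverse.map W := by
      refine List.map_congr_left fun c hc => ?_
      have hc' : c ∈ range N := by simpa using hc
      rw [hcls c hc', toFinset_sort_ge (hW c hc').2]
    refine ⟨κ, ?_, hwords⟩
    rw [mem_filter, isProperMultiColoring_iff, Fintype.mem_piFinset]
    refine ⟨fun i => mem_powerset.2 fun c hc => ?_, ⟨fun i => ?_, fun c => ?_⟩, ?_⟩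
    · rw [mem_filter] at hc
      rw [Finsupp.mem_support_iff, ← (hW c hc.1).1]
      exact (List.length_pos_of_mem hc.2).ne'
    · rw [← count_flatten_colorWords hκN i, hwords]
      exact hμ i
    · by_cases hc : c ∈ range N
      · rw [hcls c hc]
        exact isChainSet_toFinset (hW c hc).2
      · rw [hcls' c hc]
        exact isChainSet_empty
    · ext c
      rw [colorContent_apply]
      by_cases hc : c ∈ range N
      · rw [hcls c hc, ← (hW c hc).1, ← length_sort (· ≥ ·), toFinset_sort_ge (hW c hc).2]
      · rw [hcls' c hc, card_empty]
        by_contra hne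
        exact hc (hN (Finsupp.mem_support_iff.2 (Ne.symm hne)))
  · intro κ hκ
    rw [mem_filter, isProperMultiColoring_iff] at hκ
    rw [P.asc_eq_sum (hsupp hκ.1), P.inv_flatten_colorWords hκ.2.1.2]

end NatUnitIntervalOrder

/-! ### Existence and uniqueness of the expansion in forgotten functions. -/

section Forgotten

open Polynomial Finset

theorem coeff_forgottenSum (a : (Σ k : ℕ, k.Partition) →₀ ℚ[X]) {s : Finset (Σ k : ℕ, k.Partition)}
    (hs : a.support ⊆ s) (d : ℕ →₀ ℕ) : MvPowerSeries.coeff d (forgottenSum a) =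
      ∑ ν ∈ s, a ν *
        C (MvPowerSeries.coeff d (SymFn.forgotten ℚ ν.2 : MvPowerSeries ℕ ℚ)) := by
  rw [forgottenSum, Finsupp.sum, map_sum]
  simp only [MvPowerSeries.coeff_smul, MvPowerSeries.coeff_map]
  refine sum_subset hs fun ν _ hν => ?_
  rw [Finsupp.notMem_support_iff.1 hν, zero_mul]

/-- Comparing the coefficients of each power of `q` reduces this to the linear independence of the
forgotten functions over `ℚ`. -/
theorem forgottenSum_injective : Function.Injective forgottenSum := by
  classical
  intro a b hab
  have key : ∀ ν ∈ a.support ∪ b.support, ∀ j, (a ν - b ν).coeff j = 0 := by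
    intro ν hν j
    refine SymFn.eq_zero_of_sum_forgotten_eq_zero (a.support ∪ b.support)
      (fun ν => (a ν - b ν).coeff j) (fun d => ?_) ν hν
    have h := congrArg (MvPowerSeries.coeff d) hab
    rw [coeff_forgottenSum a subset_union_left, coeff_forgottenSum b subset_union_right,
      ← sub_eq_zero, ← sum_sub_distrib] at h
    have h' := congrArg (fun p : ℚ[X] => p.coeff j) h
    simpa only [← sub_mul, finsetSum_coeff, coeff_mul_C, coeff_zero] using h'
  ext1 ν
  by_cases hν : ν ∈ a.support ∪ b.support
  · rw [← sub_eq_zero]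
    ext j
    exact key ν hν j
  · rw [mem_union, not_or, Finsupp.notMem_support_iff, Finsupp.notMem_support_iff] at hν
    rw [hν.1, hν.2]

theorem degree_eq_of_coeff_chromaticQSym_ne_zero {n : ℕ} {G : SimpleGraph (Fin n)} {μ : Fin n → ℕ}
    {d : ℕ →₀ ℕ} (h : MvPowerSeries.coeff d (chromaticQSym G μ) ≠ 0) : d.degree = ∑ i, μ i := by
  classical
  obtain ⟨κ, hκ, _⟩ := exists_ne_zero_of_sum_ne_zero h
  rw [mem_filter] at hκ
  rw [← hκ.2.2, NatUnitIntervalOrder.degree_colorContent]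
  exact sum_congr rfl fun i _ => hκ.2.1.1 i

open Classical in
theorem exists_chromaticQSym_eq_forgottenSum {n : ℕ} (P : NatUnitIntervalOrder n) (μ : Fin n → ℕ) :
    ∃ a : (Σ k : ℕ, k.Partition) →₀ ℚ[X], chromaticQSym P.inc μ = forgottenSum a ∧
      ∀ ν, a ν = ∑ w ∈ wordsOfType μ with P.SegmentsDescentFree (ν.2.parts.sort (· ≥ ·)) w,
        (X : ℚ[X]) ^ P.inv w := by
  set A : (Σ k : ℕ, k.Partition) → ℚ[X] := fun ν =>
    ∑ w ∈ wordsOfType μ with P.SegmentsDescentFree (ν.2.parts.sort (· ≥ ·)) w,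
      (X : ℚ[X]) ^ P.inv w with hA
  let S : Finset (Σ k : ℕ, k.Partition) :=
    (univ : Finset (∑ i, μ i).Partition).map (Function.Embedding.sigmaMk _)
  -- A word of type `μ` has length `∑ i, μ i`, so only partitions of this number occur and the
  -- family is finitely supported.
  have hS : ∀ ν, A ν ≠ 0 → ν ∈ S := by
    rintro ⟨k, ν⟩ h
    obtain ⟨w, hw, _⟩ := exists_ne_zero_of_sum_ne_zero h
    rw [mem_filter] at hw
    obtain ⟨hw, s, rfl, hs, _⟩ := hw
    have hlen := length_of_mem_wordsOfType hw
    rw [List.length_flatten, hs, ← Multiset.sum_coe, Multiset.sort_eq, ν.parts_sum] at hlen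
    subst hlen
    exact mem_map.2 ⟨ν, mem_univ _, rfl⟩
  refine ⟨Finsupp.onFinset S A hS, ?_, fun ν => rfl⟩
  ext1 d
  rw [coeff_forgottenSum _ Finsupp.support_onFinset_subset, sum_map]
  have hN : d.support ⊆ range (d.support.sup id + 1) := fun c hc =>
    mem_range.2 (Nat.lt_succ_of_le (le_sup (f := id) hc))
  have key := P.sum_coeff_forgotten_smul_sum_listProd (P.wordWeight_mem_commSubmodule μ)
    (∑ i, μ i) d (List.range (d.support.sup id + 1)).reverse
    (List.nodup_reverse.2 List.nodup_range) (by rwa [List.toFinset_reverse, List.toFinset_range])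
  simp only [← P.sum_segmentsDescentFree, ← P.coeff_chromaticQSym_inc μ d hN] at key
  refine Eq.trans ?_ (key.symm.trans (sum_congr rfl fun ν _ => ?_))
  -- In degrees other than `∑ i, μ i` the coefficient of `chromaticQSym` vanishes too, so the case
  -- distinction in `key` disappears.
  · split_ifs with hd
    · rfl
    · by_contra hne
      exact hd (degree_eq_of_coeff_chromaticQSym_ne_zero hne)
  · rw [smul_eq_C_mul, mul_comm]
    rfl

end Forgotten

open Polynomial in
open Classical in
theorem mainTheorem9 {n : ℕ} (P : NatUnitIntervalOrder n) (μ : Fin n → ℕ) :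
    (∃ a : (Σ k : ℕ, k.Partition) →₀ ℚ[X], chromaticQSym P.inc μ = forgottenSum a) ∧
    ∀ a : (Σ k : ℕ, k.Partition) →₀ ℚ[X], chromaticQSym P.inc μ = forgottenSum a →
      ∀ ν : Σ k : ℕ, k.Partition,
        a ν = ∑ w ∈ wordsOfType μ with P.SegmentsDescentFree (ν.2.parts.sort (· ≥ ·)) w,
          (X : ℚ[X]) ^ P.inv w := by
  obtain ⟨a₀, h₀, hw⟩ := exists_chromaticQSym_eq_forgottenSum P μ
  refine ⟨⟨a₀, h₀⟩, fun a ha ν => ?_⟩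
  rw [forgottenSum_injective (ha.symm.trans h₀)]
  exact hw ν
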